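/- **Conventions.** For a measurable function $f$ on a measure space $(X,\mu)$ put $d_f(s)=\mu(\{x:|f(x)|>s\})$, $f^*(\tau)=\inf\{s\ge 0: d_f(s)\le \tau\}$ (with $\inf\emptyset=\infty$), and for $0<p<\infty$, $0<q<\infty$ let $$\|f\|_{L^{p,q}(X)}=\Big(\int_0^\infty\big(\tau^{1/p}f^*(\tau)\big)^q\,\frac{d\tau}{\tau}\Big)^{1/q}.$$ Let $\mathcal D$ be the family of dyadic cubes $Q_{j,m}=\prod_{i=1}^n[2^{-j}m_i,2^{-j}(m_i+1))$, $j\in\mathbb Z$, $m\in\mathbb Z^n$. For $0<p\le t<\infty$, $0<q<\infty$, $0<r\le\infty$, the Bourgain–Morrey–Lorentz space $M^{t,r}_{p,q}(\mathbb R^n)$ consists of all (real- or complex-valued) measurable functions $f$ on $\mathbb R^n$ with $$\|f\|_{M^{t,r}_{p,q}(\mathbb R^n)}=\Big(\sum_{Q\in\mathcal D}|Q|^{r/t-r/p}\|f\|_{L^{p,q}(Q)}^r\Big)^{1/r}<\infty,$$ where for $r=\infty$ the right-hand side is $\sup_{Q\in\mathcal D}|Q|^{1/t-1/p}\|f\|_{L^{p,q}(Q)}$.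 For $0<\alpha<n$ let $$I_\alpha f(x)=\int_{\mathbb R^n}\frac{f(y)}{|x-y|^{n-\alpha}}\,dy,\qquad \mathcal M_\alpha f(x)=\sup_{Q\ni x}\frac{1}{|Q|^{1-\alpha/n}}\int_Q|f(y)|\,dy,$$ the supremum being over all cubes $Q$ in $\mathbb R^n$ (with sides parallel to the axes) that contain $x$. **Theorem.** Let $0<\alpha<n$, let $1<q_1,q_2<\infty$, and let $t_1,t_2\in(1,\infty)$ satisfy $$\frac1{t_2}=\frac1{t_1}-\frac{\alpha}{n}.$$ Assume that either $$1<p_i<t_i<r_i<\infty\ (i=1,2)\quad\text{and}\quad \frac{p_1}{p_2}=\frac{q_1}{q_2}=\frac{t_1}{t_2}=\frac{r_1}{r_2},$$ or $$1<p_i\le t_i<r_i=\infty\ (i=1,2)\quad\text{and}\quad \frac{p_1}{p_2}=\frac{q_1}{q_2}=\frac{t_1}{t_2}.$$ Then there is a constant $C<\infty$, depending only on $n,\alpha$ and the exponents $p_i,q_i,t_i,r_i$, such that for every $f\in M^{t_1,r_1}_{p_1,q_1}(\mathbb R^n)$ the integral defining $I_\alpha f(x)$ converges absolutely for almost every $x$,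 the functions $I_\alpha f$ and $\mathcal M_\alpha f$ belong to $M^{t_2,r_2}_{p_2,q_2}(\mathbb R^n)$, and $$\|I_\alpha f\|_{M^{t_2,r_2}_{p_2,q_2}(\mathbb R^n)}\le C\,\|f\|_{M^{t_1,r_1}_{p_1,q_1}(\mathbb R^n)},\qquad \|\mathcal M_\alpha f\|_{M^{t_2,r_2}_{p_2,q_2}(\mathbb R^n)}\le C\,\|f\|_{M^{t_1,r_1}_{p_1,q_1}(\mathbb R^n)}.$$ -/

import Mathlib

open MeasureTheory Set
open scoped ENNReal NNReal

noncomputable section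

namespace BML

/-- `ℝⁿ` with the Euclidean norm and Lebesgue measure. -/
abbrev Rn (n : ℕ) : Type := EuclideanSpace ℝ (Fin n)

section Lorentz

variable {X : Type*} [MeasurableSpace X] {ε : Type*} [ENorm ε]

/-- The distribution function `d_f(s) = μ {x : |f(x)| > s}`. -/
def distrib (f : X → ε) (μ : Measure X) (s : ℝ≥0∞) : ℝ≥0∞ :=
  μ {x | s < ‖f x‖ₑ}

/-- The decreasing rearrangement `f^*(t) = inf {s ≥ 0 : d_f(s) ≤ t}`. The value `s = ∞` always
belongs to the set below, which accounts for the convention `inf ∅ = ∞`. -/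
def rearr (f : X → ε) (μ : Measure X) (t : ℝ≥0∞) : ℝ≥0∞ :=
  sInf {s : ℝ≥0∞ | distrib f μ s ≤ t}

/-- The Lorentz quasi-norm `‖f‖_{L^{p,q}(μ)}` for `0 < p, q ≤ ∞`, with values in `[0, ∞]`
(for `p = ∞` the exponent `1/p` is `(∞ : ℝ≥0∞).toReal⁻¹ = 0`). -/
def lorentzNorm (f : X → ε) (p q : ℝ≥0∞) (μ : Measure X) : ℝ≥0∞ :=
  if q = ∞ then
    ⨆ t ∈ Ioi (0 : ℝ), ENNReal.ofReal t ^ p.toReal⁻¹ * rearr f μ (ENNReal.ofReal t)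
  else
    (∫⁻ t in Ioi (0 : ℝ),
      (ENNReal.ofReal t ^ p.toReal⁻¹ * rearr f μ (ENNReal.ofReal t)) ^ q.toReal
        / ENNReal.ofReal t) ^ q.toReal⁻¹

end Lorentz

/-- The dyadic cube `Q_{j,m} = ∏ᵢ [2^{-j} mᵢ, 2^{-j} (mᵢ + 1))`. -/
def dyadicCube {n : ℕ} (j : ℤ) (m : Fin n → ℤ) : Set (Rn n) :=
  {x | ∀ i, (2 : ℝ) ^ (-j) * m i ≤ x i ∧ x i < (2 : ℝ) ^ (-j) * (m i + 1)}

section Spaces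

variable {n : ℕ} {ε : Type*} [ENorm ε]

/-- The quantity `|Q|^{1/t - 1/p} ‖f‖_{L^{p,q}(Q)}` for the dyadic cube `Q = Q_{j,m}`, `k = (j, m)`. -/
def localTerm (f : Rn n → ε) (p q t : ℝ≥0∞) (k : ℤ × (Fin n → ℤ)) : ℝ≥0∞ :=
  volume (dyadicCube k.1 k.2) ^ (t.toReal⁻¹ - p.toReal⁻¹)
    * lorentzNorm f p q (volume.restrict (dyadicCube k.1 k.2))

/-- The Bourgain-Morrey-Lorentz quasi-norm `‖f‖_{M_{p,q}^{t,r}(ℝⁿ)}`, the `ℓ^r` norm of the local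
terms over all dyadic cubes. For `n ≥ 1` the pair `(j, m)` is determined by the cube `Q_{j,m}`. -/
def bmlNorm (f : Rn n → ε) (p q t r : ℝ≥0∞) : ℝ≥0∞ :=
  if r = ∞ then ⨆ k, localTerm f p q t k
  else (∑' k, localTerm f p q t k ^ r.toReal) ^ r.toReal⁻¹

/-- `f ∈ M_{p,q}^{t,r}(ℝⁿ)`: `f` is (almost everywhere equal to) a measurable function and has
finite quasi-norm. -/
def MemBML [TopologicalSpace ε] (f : Rn n → ε) (p q t r : ℝ≥0∞) : Prop :=
  AEStronglyMeasurable f volume ∧ bmlNorm f p q t r < ∞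

end Spaces

section Operators

variable {n : ℕ} {𝕜 : Type*} [RCLike 𝕜]

/-- The integrand `y ↦ f(y) / |x - y|^{n - α}` of the fractional integral at `x`. -/
def fracKernel (α : ℝ) (f : Rn n → 𝕜) (x y : Rn n) : 𝕜 :=
  (‖x - y‖ ^ ((n : ℝ) - α))⁻¹ • f y

/-- The fractional integral `I_α f(x) = ∫ f(y) / |x - y|^{n - α} dy`. -/
def fracIntegral (α : ℝ) (f : Rn n → 𝕜) (x : Rn n) : 𝕜 :=
  ∫ y, fracKernel α f x y

/-- The cube with center `c` and side length `l`. -/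
def cube (c : Rn n) (l : ℝ) : Set (Rn n) :=
  {y | ∀ i, |y i - c i| < l / 2}

/-- The fractional maximal function `M_α f(x) = sup_{Q ∋ x} |Q|^{-(1 - α/n)} ∫_Q |f|`, the supremum
being over all cubes containing `x`, with values in `[0, ∞]`. -/
def fracMaximal (α : ℝ) (f : Rn n → 𝕜) (x : Rn n) : ℝ≥0∞ :=
  ⨆ (c : Rn n) (l : ℝ) (_ : 0 < l) (_ : x ∈ cube c l),
    (∫⁻ y in cube c l, ‖f y‖ₑ) / volume (cube c l) ^ (1 - α / n)

end Operators

end BML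

end

open MeasureTheory Set
open scoped ENNReal NNReal

noncomputable section

namespace BML

/-! ### Distribution functions and decreasing rearrangements. -/

section Rearrangement

variable {X : Type*} [MeasurableSpace X] {ε : Type*} [ENorm ε] {μ : Measure X}

/-! Put `θ = t₁ / t₂`. The relation between `t₁`, `t₂` and `α` says `1 - θ = α t₁ / n`, and the
proportionality of the exponents says that every index of the source space is `θ` times that of the
target. Hence the target norm of `h ^ θ` is the source norm of `h` to the power `θ`
(`bmlNorm_rpow`).

The second ingredient is Hedberg's estimate (`exists_fracPotential_le`): with `K` the source norm of
`f`, `I_α|f|(x) ≤ C (Mf(x))^θ K^(1-θ)`. The kernel is cut into dyadic shells; on the ball of radius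
`2^(-j)` the average of `|f|` is at most `Mf(x)` and at most a multiple of `2^(jn/t₁) K`, and the
better of the two bounds is summed over `j` with weight `2^(-jα)`. Taking target norms reduces the
theorem to the boundedness of `M` on the source space.

That boundedness (`exists_bmlNorm_maxBall_le`) is proved cube by cube. Radii below the side of `Q`
only see the neighbours of `Q`; there `M` is bounded on the Lorentz space, by the weak (1,1)
inequality, truncation at height `g*(τ)` and Hardy's inequality (`rearr_maxBall_le`,
`exists_lorentzInt_hardy`). Larger radii give averages near the ancestors of `Q`, which Hölder's
inequality bounds by the local terms there with a gain `2^(-kn/t₁)` at the `k`-th ancestor. Each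
cube is a `k`-th ancestor `2^(nk)` times, so the `ℓ^r` sum converges because `r₁ > t₁`.

Finally `M_α f ≤ C I_α|f|` pointwise, and finiteness of the norm of `I_α|f|` yields absolute
convergence almost everywhere. -/

lemma distrib_antitone (f : X → ε) (μ : Measure X) : Antitone (distrib f μ) :=
  fun _ _ h => measure_mono fun _ hx => lt_of_le_of_lt h hx

lemma rearr_antitone (f : X → ε) (μ : Measure X) : Antitone (rearr f μ) :=
  fun _ _ h => sInf_le_sInf fun _ hs => le_trans hs h

/-- Monotonicity suffices, so `f` itself need not be measurable. This is why measurability of the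
maximal function `maxBall` is never needed. -/
lemma measurable_rearr (f : X → ε) (μ : Measure X) : Measurable (rearr f μ) :=
  (rearr_antitone f μ).measurable

lemma rearr_le_of_distrib_le {f : X → ε} {s t : ℝ≥0∞} (h : distrib f μ s ≤ t) :
    rearr f μ t ≤ s := sInf_le h

/-- The infimum defining the rearrangement is attained: strict superlevel sets increase to the one
at the infimum, and measures are continuous along increasing unions. -/
lemma distrib_rearr_le (f : X → ε) (μ : Measure X) (t : ℝ≥0∞) :
    distrib f μ (rearr f μ t) ≤ t := by
  rcases eq_or_ne (rearr f μ t) ∞ with h | h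
  · simp [distrib, h]
  have key : {x | rearr f μ t < ‖f x‖ₑ} =
      ⋃ k : ℕ, {x | rearr f μ t + ((k : ℝ≥0∞) + 1)⁻¹ < ‖f x‖ₑ} := by
    ext x
    simp only [mem_ofPred_eq, mem_iUnion]
    constructor
    · intro hx
      have h0 : ‖f x‖ₑ - rearr f μ t ≠ 0 := (tsub_pos_of_lt hx).ne'
      obtain ⟨k, hk⟩ := ENNReal.exists_inv_nat_lt h0
      refine ⟨k, ?_⟩
      rw [add_comm]
      refine lt_tsub_iff_right.1 (lt_of_le_of_lt ?_ hk)
      exact ENNReal.inv_le_inv.2 (by simp)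
    · rintro ⟨k, hk⟩
      exact lt_of_le_of_lt le_self_add hk
  have hmono : Monotone fun k : ℕ => {x | rearr f μ t + ((k : ℝ≥0∞) + 1)⁻¹ < ‖f x‖ₑ} := by
    intro a b hab x hx
    simp only [mem_ofPred_eq] at hx ⊢
    refine lt_of_le_of_lt ?_ hx
    gcongr
  rw [distrib, key, hmono.measure_iUnion]
  refine iSup_le fun k => ?_
  have hlt : rearr f μ t < rearr f μ t + ((k : ℝ≥0∞) + 1)⁻¹ :=
    ENNReal.lt_add_right h (by simp)
  obtain ⟨s, hs, hs'⟩ := sInf_lt_iff.1 hlt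
  exact le_trans (distrib_antitone f μ hs'.le) hs

lemma rearr_enorm (f : X → ε) (μ : Measure X) : rearr (fun x => ‖f x‖ₑ) μ = rearr f μ := by
  ext t; simp [rearr, distrib]

lemma rearr_mono {ε' : Type*} [ENorm ε'] {f : X → ε} {g : X → ε'} (h : ∀ x, ‖f x‖ₑ ≤ ‖g x‖ₑ)
    (μ : Measure X) (t : ℝ≥0∞) : rearr f μ t ≤ rearr g μ t :=
  rearr_le_of_distrib_le <| le_trans (measure_mono fun x hx => lt_of_lt_of_le hx (h x))
    (distrib_rearr_le g μ t)

lemma rearr_eq_zero_of_measure_le (f : X → ε) {t : ℝ≥0∞} (h : μ univ ≤ t) :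
    rearr f μ t = 0 :=
  le_antisymm (rearr_le_of_distrib_le ((measure_mono (subset_univ _)).trans h)) bot_le

/-- An order isomorphism of `[0, ∞]` only relabels the superlevel sets. Applied to powers, it gives
the scaling of the norms in `θ`. -/
lemma rearr_comp_orderIso (e : ℝ≥0∞ ≃o ℝ≥0∞) (g : X → ℝ≥0∞) (μ : Measure X) (t : ℝ≥0∞) :
    rearr (fun x => e (g x)) μ t = e (rearr g μ t) := by
  apply le_antisymm
  · refine rearr_le_of_distrib_le ?_
    simpa [distrib] using distrib_rearr_le g μ t
  · rw [← e.symm.le_iff_le, e.symm_apply_apply]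
    refine rearr_le_of_distrib_le ?_
    have := distrib_rearr_le (fun x => e (g x)) μ t
    simpa [distrib, e.symm_apply_lt] using this

lemma rearr_rpow (g : X → ℝ≥0∞) (μ : Measure X) {θ : ℝ} (hθ : 0 < θ) (t : ℝ≥0∞) :
    rearr (fun x => g x ^ θ) μ t = rearr g μ t ^ θ :=
  rearr_comp_orderIso (ENNReal.orderIsoRpow θ hθ) g μ t

lemma rearr_const_mul_le (c : ℝ≥0∞) (g : X → ℝ≥0∞) (μ : Measure X) (t : ℝ≥0∞) :
    rearr (fun x => c * g x) μ t ≤ c * rearr g μ t := by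
  refine rearr_le_of_distrib_le (le_trans (measure_mono fun x hx => ?_) (distrib_rearr_le g μ t))
  simp only [mem_ofPred_eq, enorm_eq_self] at hx ⊢
  exact lt_of_not_ge fun h => absurd hx (not_lt.2 (by gcongr))

/-- The part of `g` above its rearrangement at `τ` is controlled by a dyadic sum of values of the
rearrangement. -/
lemma lintegral_indicator_rearr_lt_le {g : X → ℝ≥0∞} (hg : AEMeasurable g μ) {τ : ℝ≥0∞}
    (hτ : τ ≠ ∞) :
    ∫⁻ x, {x | rearr g μ τ < g x}.indicator g x ∂μ ≤
      ∑' k : ℕ, rearr g μ (2⁻¹ ^ (k + 1) * τ) * (2⁻¹ ^ k * τ) := by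
  set a : ℕ → ℝ≥0∞ := fun k => rearr g μ (2⁻¹ ^ k * τ) with ha
  have hmeas : ∀ k, μ {x | a k < g x} ≤ 2⁻¹ ^ k * τ := fun k => by
    simpa [distrib] using distrib_rearr_le g μ (2⁻¹ ^ k * τ)
  have hnull : μ {x | ∀ k, a k < g x} = 0 := by
    refine le_antisymm (ge_of_tendsto' (x := Filter.atTop) (f := fun k : ℕ => 2⁻¹ ^ k * τ) ?_
      fun k => le_trans (measure_mono fun x hx => hx k) (hmeas k)) bot_le
    have := ENNReal.Tendsto.mul_const (b := τ)
      (ENNReal.tendsto_pow_atTop_nhds_zero_of_lt_one (r := 2⁻¹) (by simp)) (Or.inr hτ)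
    simpa using this
  -- Almost every point above the level `a 0` lies in a layer `a k < g x ≤ a (k + 1)`, where `k + 1`
  -- is the first index with `g x ≤ a (k + 1)`.
  have hpt : ∀ᵐ x ∂μ, {x | rearr g μ τ < g x}.indicator g x ≤
      ∑' k : ℕ, {x | a k < g x}.indicator (fun _ => a (k + 1)) x := by
    have : ∀ᵐ x ∂μ, ¬ ∀ k, a k < g x := by simpa [ae_iff] using hnull
    filter_upwards [this] with x hx
    by_cases h0 : rearr g μ τ < g x
    · rw [indicator_of_mem (show x ∈ {x | rearr g μ τ < g x} from h0)]
      push Not at hx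
      classical
      have hfind := Nat.find_spec hx
      obtain ⟨k, hk⟩ : ∃ k, Nat.find hx = k + 1 := by
        refine Nat.exists_eq_succ_of_ne_zero fun h => ?_
        rw [h] at hfind
        simp only [ha, pow_zero, one_mul] at hfind
        exact absurd h0 (not_lt.2 hfind)
      have hlt : a k < g x := by
        have := Nat.find_min hx (m := k) (by omega)
        exact not_le.1 this
      rw [hk] at hfind
      refine le_trans ?_ (ENNReal.le_tsum k)
      rw [indicator_of_mem (show x ∈ {x | a k < g x} from hlt)]
      exact hfind
    · rw [indicator_of_notMem (show x ∉ {x | rearr g μ τ < g x} from h0)]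
      exact bot_le
  have hms : ∀ k, NullMeasurableSet {x | a k < g x} μ := fun k =>
    nullMeasurableSet_lt aemeasurable_const hg
  calc _ ≤ ∫⁻ x, ∑' k : ℕ, {x | a k < g x}.indicator (fun _ => a (k + 1)) x ∂μ :=
        lintegral_mono_ae hpt
    _ = ∑' k, a (k + 1) * μ {x | a k < g x} := by
        rw [lintegral_tsum fun k => (aemeasurable_const.indicator₀ (hms k))]
        congr with k
        rw [lintegral_indicator_const₀ (hms k)]
    _ ≤ _ := ENNReal.tsum_le_tsum fun k => by gcongr; exact hmeas k

end Rearrangement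

/-- The `q`-th power of the Lorentz functional of a function on `(0, ∞)`. -/
def lorentzInt (p q : ℝ) (h : ℝ≥0∞ → ℝ≥0∞) : ℝ≥0∞ :=
  ∫⁻ t in Ioi (0 : ℝ), (ENNReal.ofReal t ^ p⁻¹ * h (ENNReal.ofReal t)) ^ q / ENNReal.ofReal t

/-! ### The Lorentz functional on the half-line and Hardy's inequality. -/

section LorentzInt

variable {p q : ℝ}

lemma lorentzNorm_eq {X : Type*} [MeasurableSpace X] {ε : Type*} [ENorm ε] (f : X → ε)
    (μ : Measure X) (hp : 0 < p) (hq : 0 < q) :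
    lorentzNorm f (ENNReal.ofReal p) (ENNReal.ofReal q) μ = lorentzInt p q (rearr f μ) ^ q⁻¹ := by
  simp [lorentzNorm, lorentzInt, ENNReal.toReal_ofReal hp.le, ENNReal.toReal_ofReal hq.le]

lemma lorentzInt_mono (hq : 0 < q) {h h' : ℝ≥0∞ → ℝ≥0∞}
    (hh : ∀ t, t ≠ 0 → t ≠ ∞ → h t ≤ h' t) : lorentzInt p q h ≤ lorentzInt p q h' := by
  refine setLIntegral_mono' measurableSet_Ioi fun t ht => ?_
  have := hh (ENNReal.ofReal t) (by simpa using ht) (by simp)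
  gcongr

lemma lorentzInt_const_mul (hq : 0 < q) {c : ℝ≥0∞} (hc : c ≠ ∞) (h : ℝ≥0∞ → ℝ≥0∞) :
    lorentzInt p q (fun t => c * h t) = c ^ q * lorentzInt p q h := by
  rw [lorentzInt, lorentzInt, ← lintegral_const_mul' _ _ (by simp [hq.le, hc])]
  congr with t
  rw [mul_left_comm, ENNReal.mul_rpow_of_nonneg _ _ hq.le, mul_div_assoc]

lemma measurable_lorentzInt_integrand {h : ℝ≥0∞ → ℝ≥0∞} (hh : Measurable h) : Measurable fun t : ℝ =>
    (ENNReal.ofReal t ^ p⁻¹ * h (ENNReal.ofReal t)) ^ q / ENNReal.ofReal t := by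
  have := hh.comp ENNReal.measurable_ofReal
  simp only [Function.comp_def] at this
  fun_prop

/-- Unlike `lorentzInt_const_mul`, this admits `c = ∞`, as needed for a supremum of averages not yet
known to be finite. -/
lemma lorentzInt_const_mul_of_measurable (hq : 0 < q) (c : ℝ≥0∞) {h : ℝ≥0∞ → ℝ≥0∞}
    (hh : Measurable h) : lorentzInt p q (fun t => c * h t) = c ^ q * lorentzInt p q h := by
  rw [lorentzInt, lorentzInt, ← lintegral_const_mul _ (measurable_lorentzInt_integrand hh)]
  congr with t
  rw [mul_left_comm, ENNReal.mul_rpow_of_nonneg _ _ hq.le, mul_div_assoc]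

/-- The `q`-th power commutes with suprema, and a supremum is at most a sum. This replaces the
triangle inequality and works for every `q > 0`. -/
lemma lorentzInt_le_tsum_of_le_iSup (hq : 0 < q) {ι : Type*} [Countable ι] {h : ℝ≥0∞ → ℝ≥0∞}
    {a : ι → ℝ≥0∞ → ℝ≥0∞} (ha : ∀ i, Measurable (a i))
    (hh : ∀ t, t ≠ 0 → t ≠ ∞ → h t ≤ ⨆ i, a i t) :
    lorentzInt p q h ≤ ∑' i, lorentzInt p q (a i) := by
  simp only [lorentzInt]
  rw [← lintegral_tsum fun i => (measurable_lorentzInt_integrand (ha i)).aemeasurable]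
  refine setLIntegral_mono' measurableSet_Ioi fun t ht => ?_
  have h1 := hh (ENNReal.ofReal t) (by simpa using ht) (by simp)
  set T := ENNReal.ofReal t
  have : (T ^ p⁻¹ * h T) ^ q ≤ ∑' i, (T ^ p⁻¹ * a i T) ^ q := by
    calc (T ^ p⁻¹ * h T) ^ q ≤ (⨆ i, T ^ p⁻¹ * a i T) ^ q := by
          rw [← ENNReal.mul_iSup]; gcongr
      _ = ⨆ i, (T ^ p⁻¹ * a i T) ^ q := (ENNReal.orderIsoRpow q hq).map_iSup _
      _ ≤ _ := iSup_le fun i => ENNReal.le_tsum i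
  simp only [div_eq_mul_inv]
  rw [ENNReal.tsum_mul_right]
  gcongr

lemma lorentzInt_add_le (hq : 0 < q) {a b : ℝ≥0∞ → ℝ≥0∞} (ha : Measurable a) (hb : Measurable b) :
    lorentzInt p q (fun t => a t + b t) ≤
      2 ^ q * (lorentzInt p q a + lorentzInt p q b) := by
  have h2 : (2 : ℝ≥0∞) ≠ ∞ := by simp
  rw [mul_add, ← lorentzInt_const_mul hq h2, ← lorentzInt_const_mul hq h2]
  have := lorentzInt_le_tsum_of_le_iSup (p := p) (q := q) hq (ι := Bool) (h := fun t => a t + b t)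
    (a := fun i t => if i then 2 * a t else 2 * b t)
    (fun i => by cases i <;> simp <;> fun_prop) (fun t _ _ => by
      rw [iSup_bool_eq]
      simp only [if_true, Bool.false_eq_true, if_false]
      rcases le_total (a t) (b t) with h | h
      · refine le_trans ?_ le_sup_right
        rw [two_mul]; gcongr
      · refine le_trans ?_ le_sup_left
        rw [two_mul]; gcongr)
  simpa [tsum_fintype] using this

lemma lintegral_Ioi_comp_mul_left {c : ℝ} (hc : 0 < c) (F : ℝ → ℝ≥0∞) :
    ∫⁻ t in Ioi (0 : ℝ), F (c * t) = (ENNReal.ofReal c)⁻¹ * ∫⁻ t in Ioi (0 : ℝ), F t := by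
  have e : MeasurableEmbedding (fun t : ℝ => c * t) :=
    (Homeomorph.mulLeft₀ c hc.ne').measurableEmbedding
  have h1 : ∫⁻ t in Ioi (0 : ℝ), F t ∂(Measure.map (fun t => c * t) volume) =
      ∫⁻ t in Ioi (0 : ℝ), F (c * t) := by
    rw [e.restrict_map, e.lintegral_map]
    congr 2
    ext t
    simp [hc]
  rw [← h1, Real.map_volume_mul_left hc.ne', Measure.restrict_smul, lintegral_smul_measure,
    abs_of_pos (inv_pos.2 hc), ENNReal.ofReal_inv_of_pos hc, smul_eq_mul]

/-- Since `dt / t` is invariant under dilation, only the weight `t ^ (q / p)` produces a factor. -/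
lemma lorentzInt_comp_mul (hq : 0 < q) {c : ℝ≥0∞} (hc : c ≠ 0) (hc' : c ≠ ∞)
    (h : ℝ≥0∞ → ℝ≥0∞) :
    lorentzInt p q (fun t => h (c * t)) = (c⁻¹) ^ (q / p) * lorentzInt p q h := by
  have hcr : 0 < c.toReal := ENNReal.toReal_pos hc hc'
  have hce : ENNReal.ofReal c.toReal = c := ENNReal.ofReal_toReal hc'
  have key : ∀ t : ℝ, (ENNReal.ofReal t ^ p⁻¹ * h (c * ENNReal.ofReal t)) ^ q / ENNReal.ofReal t =
      (c⁻¹) ^ (q / p) * c * ((ENNReal.ofReal (c.toReal * t) ^ p⁻¹ *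
        h (ENNReal.ofReal (c.toReal * t))) ^ q / ENNReal.ofReal (c.toReal * t)) := by
    intro t
    rw [ENNReal.ofReal_mul hcr.le, hce]
    set T := ENNReal.ofReal t
    have hT : T ≠ ∞ := by simp [T]
    rw [ENNReal.mul_rpow_of_ne_top hc' hT, ENNReal.div_eq_inv_mul, ENNReal.div_eq_inv_mul,
      ENNReal.mul_inv (Or.inl hc) (Or.inl hc'), mul_assoc (c ^ p⁻¹),
      ENNReal.mul_rpow_of_nonneg (c ^ p⁻¹) _ hq.le, ← ENNReal.rpow_mul, ENNReal.inv_rpow]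
    have h1 : (c ^ (q / p))⁻¹ * c ^ (p⁻¹ * q) = 1 := by
      rw [show p⁻¹ * q = q / p by ring]
      exact ENNReal.inv_mul_cancel (by simp [hc, hc']) (by simp [hc, hc'])
    have h2 : c * c⁻¹ = 1 := ENNReal.mul_inv_cancel hc hc'
    calc _ = ((c ^ (q / p))⁻¹ * c ^ (p⁻¹ * q)) * (c * c⁻¹) *
          (T⁻¹ * (T ^ p⁻¹ * h (c * T)) ^ q) := by rw [h1, h2, one_mul, one_mul]
      _ = _ := by ring
  simp only [lorentzInt, key]
  rw [lintegral_const_mul' _ _ (by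
    refine ENNReal.mul_ne_top ?_ hc'
    simp [ENNReal.rpow_eq_top_iff, hc, hc']), lintegral_Ioi_comp_mul_left hcr (fun t =>
    (ENNReal.ofReal t ^ p⁻¹ * h (ENNReal.ofReal t)) ^ q / ENNReal.ofReal t), hce, ← mul_assoc,
    mul_assoc _ c, ENNReal.mul_inv_cancel hc hc', mul_one]

/-- The embedding of `L^{p,q}` into weak `L^p`: on `(τ/2, τ)` an antitone `h` is at least `h τ`. -/
lemma rpow_mul_le_lorentzInt (hp : 0 < p) (hq : 0 < q) {h : ℝ≥0∞ → ℝ≥0∞} (hh : Antitone h)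
    {τ : ℝ≥0∞} (h0 : τ ≠ 0) (hτ : τ ≠ ∞) :
    (τ ^ p⁻¹ * h τ) ^ q ≤ 2 * 2 ^ (q / p) * lorentzInt p q h := by
  have hr : 0 < τ.toReal := ENNReal.toReal_pos h0 hτ
  have hre : ENNReal.ofReal τ.toReal = τ := ENNReal.ofReal_toReal hτ
  have h1 : (2⁻¹ * τ) * (((2⁻¹ * τ) ^ p⁻¹ * h τ) ^ q / τ) ≤ lorentzInt p q h := by
    calc _ = ∫⁻ t in Ioo (τ.toReal / 2) τ.toReal, (((2⁻¹ * τ) ^ p⁻¹ * h τ) ^ q / τ) := by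
          rw [setLIntegral_const, Real.volume_Ioo, mul_comm]
          congr 1
          rw [show τ.toReal - τ.toReal / 2 = 2⁻¹ * τ.toReal by ring,
            ENNReal.ofReal_mul (by norm_num), hre, ENNReal.ofReal_inv_of_pos (by norm_num)]
          simp
      _ ≤ ∫⁻ t in Ioo (τ.toReal / 2) τ.toReal,
          (ENNReal.ofReal t ^ p⁻¹ * h (ENNReal.ofReal t)) ^ q / ENNReal.ofReal t := by
          refine setLIntegral_mono' measurableSet_Ioo fun t ht => ?_
          have ha : ENNReal.ofReal t ≤ τ := by
            rw [← hre]; exact ENNReal.ofReal_le_ofReal ht.2.le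
          have hb : 2⁻¹ * τ ≤ ENNReal.ofReal t := by
            have : ENNReal.ofReal (2⁻¹ * τ.toReal) = 2⁻¹ * τ := by
              rw [ENNReal.ofReal_mul (by norm_num), hre, ENNReal.ofReal_inv_of_pos (by norm_num)]
              simp
            rw [← this]
            exact ENNReal.ofReal_le_ofReal (by linarith [ht.1])
          have hc := hh ha
          gcongr
      _ ≤ _ := lintegral_mono_set fun t ht => by
          have := ht.1
          simp only [mem_Ioi]; linarith
  have h2 : (2⁻¹ * τ) * (((2⁻¹ * τ) ^ p⁻¹ * h τ) ^ q / τ) =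
      (2 * 2 ^ (q / p))⁻¹ * (τ ^ p⁻¹ * h τ) ^ q := by
    rw [ENNReal.mul_rpow_of_nonneg 2⁻¹ τ (by positivity), mul_assoc ((2⁻¹ : ℝ≥0∞) ^ p⁻¹),
      ENNReal.mul_rpow_of_nonneg ((2⁻¹ : ℝ≥0∞) ^ p⁻¹) _ hq.le, ← ENNReal.rpow_mul,
      show p⁻¹ * q = q / p by ring, ENNReal.mul_inv (by simp) (by simp), ENNReal.inv_rpow,
      div_eq_mul_inv]
    have : τ * τ⁻¹ = 1 := ENNReal.mul_inv_cancel h0 hτ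
    calc _ = 2⁻¹ * (2 ^ (q / p))⁻¹ * (τ ^ p⁻¹ * h τ) ^ q * (τ * τ⁻¹) := by ring
      _ = _ := by rw [this, mul_one]
  rw [h2] at h1
  have hne : (2 * 2 ^ (q / p) : ℝ≥0∞) ≠ 0 := by simp
  have hne' : (2 * 2 ^ (q / p) : ℝ≥0∞) ≠ ∞ := ENNReal.mul_ne_top (by simp) (by simp)
  rwa [ENNReal.inv_mul_le_iff hne hne'] at h1

lemma lorentzInt_indicator_lt_top (hp : 0 < p) (hq : 0 < q) :
    lorentzInt p q ((Iio 1).indicator fun _ => 1) < ∞ := by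
  have hint : IntegrableOn (fun x : ℝ => x ^ (q / p - 1)) (Ioo 0 1) :=
    (intervalIntegral.integrableOn_Ioo_rpow_iff one_pos).2 (by linarith [div_pos hq hp])
  refine lt_of_le_of_lt ?_ hint.lintegral_lt_top
  rw [lorentzInt, ← lintegral_indicator measurableSet_Ioi, ← lintegral_indicator measurableSet_Ioo]
  refine lintegral_mono fun t => ?_
  by_cases h0 : 0 < t
  · rw [indicator_of_mem (show t ∈ Ioi (0 : ℝ) from h0)]
    by_cases h1 : t < 1
    · rw [indicator_of_mem (show t ∈ Ioo (0 : ℝ) 1 from ⟨h0, h1⟩),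
        indicator_of_mem (by simpa using h1), mul_one, ← ENNReal.rpow_mul,
        ENNReal.ofReal_rpow_of_pos h0, ← ENNReal.ofReal_div_of_pos h0, Real.rpow_sub_one h0.ne',
        show p⁻¹ * q = q / p by ring]
    · rw [indicator_of_notMem (show ENNReal.ofReal t ∉ Iio 1 by simpa using h1)]
      simp [hq]
  · rw [indicator_of_notMem (show t ∉ Ioi (0 : ℝ) from h0)]
    exact bot_le

lemma lorentzInt_indicator_Iio (hq : 0 < q) {c T : ℝ≥0∞} (hc : c ≠ 0) (hc' : c ≠ ∞) :
    lorentzInt p q ((Iio c).indicator fun _ => T) =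
      T ^ q * c ^ (q / p) * lorentzInt p q ((Iio 1).indicator fun _ => 1) := by
  have : ((Iio c).indicator fun _ => T) =
      fun t => T * (fun t => (Iio (1 : ℝ≥0∞)).indicator (fun _ => 1) (c⁻¹ * t)) t := by
    ext t
    by_cases h : t < c
    · have h' : c⁻¹ * t < 1 := by
        rw [mul_comm, ← div_eq_mul_inv]
        exact (ENNReal.div_lt_iff (Or.inl hc) (Or.inl hc')).2 (by simpa using h)
      simp [indicator_of_mem (show t ∈ Iio c from h), indicator_of_mem (show c⁻¹ * t ∈ Iio 1 from h')]
    · have h' : ¬ c⁻¹ * t < 1 := by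
        rw [mul_comm, ← div_eq_mul_inv]
        exact fun h2 => h (by simpa using (ENNReal.div_lt_iff (Or.inl hc) (Or.inl hc')).1 h2)
      simp [indicator_of_notMem (show t ∉ Iio c from h),
        indicator_of_notMem (show c⁻¹ * t ∉ Iio 1 from h')]
  have hmeas : Measurable fun t : ℝ≥0∞ => (Iio (1 : ℝ≥0∞)).indicator (fun _ => (1 : ℝ≥0∞)) (c⁻¹ * t) :=
    (measurable_const.indicator measurableSet_Iio).comp (measurable_id.const_mul _)
  rw [this, lorentzInt_const_mul_of_measurable hq T hmeas, lorentzInt_comp_mul hq (by simpa using hc')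
    (by simpa using hc), inv_inv, mul_assoc]

lemma tsum_two_rpow_neg_lt_top {s : ℝ} (hs : 0 < s) :
    ∑' k : ℕ, (2 : ℝ≥0∞) ^ (-(s * k)) < ∞ := by
  have : ∀ k : ℕ, (2 : ℝ≥0∞) ^ (-(s * k)) = ((2 : ℝ≥0∞) ^ (-s)) ^ k := fun k => by
    rw [← ENNReal.rpow_natCast, ← ENNReal.rpow_mul]; congr 1; ring
  simp only [this, ENNReal.tsum_geometric]
  have hlt : (2 : ℝ≥0∞) ^ (-s) < 1 := ENNReal.rpow_lt_one_of_one_lt_of_neg (by norm_num) (by linarith)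
  simpa using hlt

/-- A dyadic form of Hardy's inequality. -/
lemma exists_lorentzInt_hardy (hp : 1 < p) (hq : 0 < q) : ∃ C : ℝ≥0∞, C ≠ ∞ ∧
    ∀ h : ℝ≥0∞ → ℝ≥0∞, Measurable h →
      lorentzInt p q (fun t => ∑' k : ℕ, 2⁻¹ ^ k * h (2⁻¹ ^ (k + 1) * t)) ≤
        C * lorentzInt p q h := by
  have hp0 : 0 < p := by linarith
  have hp1 : p⁻¹ < 1 := inv_lt_one_of_one_lt₀ hp
  -- Half of the gap `1 - 1/p`. Write `2^(-k) = 2^(-ek) 2^(-(1-e)k)`: the first factor turns the sum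
  -- into a supremum, and the second beats the dilation cost `2^((k+1)/p)` with `2^(-ek)` to spare.
  set e : ℝ := (1 - p⁻¹) / 2 with he
  have he0 : 0 < e := by rw [he]; linarith
  set S := ∑' k : ℕ, (2 : ℝ≥0∞) ^ (-(e * k)) with hS
  have hStop : S ≠ ∞ := (tsum_two_rpow_neg_lt_top he0).ne
  set S' := ∑' k : ℕ, (2 : ℝ≥0∞) ^ (-((e * q) * k)) with hS'
  have hStop' : S' ≠ ∞ := (tsum_two_rpow_neg_lt_top (mul_pos he0 hq)).ne
  refine ⟨S ^ q * (2 ^ (q / p) * S'), ENNReal.mul_ne_top (by simp [hStop, hq.le])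
    (ENNReal.mul_ne_top (by simp) hStop'), fun h hh => ?_⟩
  have hw : ∀ x : ℝ, (2 : ℝ≥0∞) ^ x ≠ ∞ := fun x => by simp
  set a : ℕ → ℝ≥0∞ → ℝ≥0∞ := fun k t => 2 ^ (-((1 - e) * k)) * h (2⁻¹ ^ (k + 1) * t) with ha
  have h1 : ∀ t, ∑' k : ℕ, 2⁻¹ ^ k * h (2⁻¹ ^ (k + 1) * t) ≤ S * ⨆ k, a k t := fun t => by
    rw [hS, ← ENNReal.tsum_mul_right]
    refine ENNReal.tsum_le_tsum fun k => ?_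
    calc _ = 2 ^ (-(e * k)) * a k t := by
          rw [ha]
          simp only
          rw [← mul_assoc, ← ENNReal.rpow_add _ _ (by simp) (by simp),
            show -(e * k) + -((1 - e) * k) = -(k : ℝ) by ring, ENNReal.rpow_neg,
            ENNReal.rpow_natCast, ENNReal.inv_pow]
      _ ≤ _ := by gcongr; exact le_iSup (fun k => a k t) k
  calc _ ≤ lorentzInt p q (fun t => S * ⨆ k, a k t) := lorentzInt_mono hq fun t _ _ => h1 t
    _ = S ^ q * lorentzInt p q (fun t => ⨆ k, a k t) := lorentzInt_const_mul hq hStop _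
    _ ≤ S ^ q * ∑' k, lorentzInt p q (a k) := by
        gcongr
        refine lorentzInt_le_tsum_of_le_iSup hq (fun k => ?_) fun t _ _ => le_rfl
        exact (hh.comp (measurable_const.mul measurable_id)).const_mul _
    _ = S ^ q * ((2 ^ (q / p) * S') * lorentzInt p q h) := by
        congr 1
        rw [hS', ← ENNReal.tsum_mul_left, ← ENNReal.tsum_mul_right]
        congr with k
        rw [ha]
        simp only
        rw [lorentzInt_const_mul hq (hw _), lorentzInt_comp_mul hq (by simp) (by simp),
          ← mul_assoc]
        congr 1
        have : ((2⁻¹ : ℝ≥0∞) ^ (k + 1))⁻¹ = 2 ^ ((k : ℝ) + 1) := by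
          rw [← ENNReal.inv_pow, inv_inv, ← ENNReal.rpow_natCast]; push_cast; rfl
        rw [this, ← ENNReal.rpow_mul, ← ENNReal.rpow_mul, ← ENNReal.rpow_add _ _ (by simp) (by simp),
          ← ENNReal.rpow_add _ _ (by simp) (by simp)]
        congr 1
        have hpe : p⁻¹ = 1 - 2 * e := by rw [he]; ring
        rw [div_eq_mul_inv, hpe]; ring
    _ = _ := by ring

end LorentzInt

/-! ### The maximal function over balls: weak type (1,1) and Lorentz bounds. -/

section Maximal

variable {n : ℕ}

/-- The centred maximal function over Euclidean balls of dyadic radius, normalised by the power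
`ρ ^ n` of the radius. -/
def maxBall (g : Rn n → ℝ≥0∞) (x : Rn n) : ℝ≥0∞ :=
  ⨆ j : ℤ, 2 ^ ((j : ℝ) * n) * ∫⁻ y in Metric.closedBall x ((2 : ℝ) ^ (-j)), g y

lemma ofReal_two_zpow (j : ℤ) : ENNReal.ofReal ((2 : ℝ) ^ j) = (2 : ℝ≥0∞) ^ (j : ℝ) := by
  rw [← Real.rpow_intCast, ← ENNReal.ofReal_rpow_of_pos two_pos]; simp

lemma ofReal_two_zpow_neg_pow (j : ℤ) (n : ℕ) :
    ENNReal.ofReal (((2 : ℝ) ^ (-j)) ^ n) = (2 : ℝ≥0∞) ^ (-((j : ℝ) * n)) := by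
  rw [ENNReal.ofReal_pow (by positivity), ofReal_two_zpow, ← ENNReal.rpow_natCast,
    ← ENNReal.rpow_mul]
  congr 1; push_cast; ring

lemma two_rpow_mul_two_rpow_neg (x : ℝ) : (2 : ℝ≥0∞) ^ x * 2 ^ (-x) = 1 := by
  rw [← ENNReal.rpow_add _ _ (by simp) (by simp)]; simp

/-- The weak type `(1, 1)` inequality. -/
lemma mul_volume_lt_maxBall_le (hn : n ≠ 0) (g : Rn n → ℝ≥0∞) (s : ℝ≥0∞) :
    s * volume {x | s < maxBall g x} ≤
      4 ^ n * volume (Metric.ball (0 : Rn n) 1) * ∫⁻ y, g y := by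
  set v := volume (Metric.ball (0 : Rn n) 1) with hv
  have hv0 : v ≠ 0 := (Metric.measure_ball_pos _ _ one_pos).ne'
  set G := ∫⁻ y, g y with hG
  rcases eq_or_ne s 0 with rfl | hs0
  · simp
  rcases eq_or_ne G ∞ with hGt | hGt
  · rw [hGt, ENNReal.mul_top (by simp [hv0])]; exact le_top
  rcases eq_or_ne s ∞ with rfl | hst
  · simp
  set t : Set (Rn n × ℤ) :=
    {a | s < 2 ^ ((a.2 : ℝ) * n) * ∫⁻ y in Metric.closedBall a.1 ((2 : ℝ) ^ (-a.2)), g y} with ht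
  have hbound : ∀ a ∈ t, s * 2 ^ (-((a.2 : ℝ) * n)) ≤
      ∫⁻ y in Metric.closedBall a.1 ((2 : ℝ) ^ (-a.2)), g y := by
    intro a ha
    have ha' : s < 2 ^ ((a.2 : ℝ) * n) *
      ∫⁻ y in Metric.closedBall a.1 ((2 : ℝ) ^ (-a.2)), g y := ha
    calc s * 2 ^ (-((a.2 : ℝ) * n)) ≤ (2 ^ ((a.2 : ℝ) * n) *
          ∫⁻ y in Metric.closedBall a.1 ((2 : ℝ) ^ (-a.2)), g y) * 2 ^ (-((a.2 : ℝ) * n)) := by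
          gcongr
      _ = (2 ^ ((a.2 : ℝ) * n) * 2 ^ (-((a.2 : ℝ) * n))) *
          ∫⁻ y in Metric.closedBall a.1 ((2 : ℝ) ^ (-a.2)), g y := by ring
      _ = _ := by rw [two_rpow_mul_two_rpow_neg, one_mul]
  -- Vitali's lemma needs bounded radii: a radius `ρ ≥ 1` in the family satisfies `ρ ≤ ρ ^ n ≤ G /
  -- s`.
  have hrad : ∀ a ∈ t, (2 : ℝ) ^ (-a.2) ≤ max 1 (G / s).toReal := by
    intro a ha
    rcases le_total ((2 : ℝ) ^ (-a.2)) 1 with h | h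
    · exact h.trans (le_max_left _ _)
    · refine le_trans (le_trans (le_self_pow₀ h hn) ?_) (le_max_right _ _)
      rw [← ENNReal.ofReal_le_iff_le_toReal (ENNReal.div_ne_top hGt hs0), ofReal_two_zpow_neg_pow,
        ENNReal.le_div_iff_mul_le (Or.inl hs0) (Or.inl hst), mul_comm]
      exact (hbound a ha).trans (setLIntegral_le_lintegral _ _)
  -- Any enlargement factor greater than `3` is admissible; `4` is the source of the constant `4 ^
  -- n`.
  obtain ⟨u, hut, hdisj, hcov⟩ := Vitali.exists_disjoint_subfamily_covering_enlargement_closedBall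
    t (fun a => a.1) (fun a => (2 : ℝ) ^ (-a.2)) _ hrad 4 (by norm_num)
  have hcount : u.Countable := hdisj.countable_of_nonempty_interior fun a _ =>
    ⟨a.1, Metric.ball_subset_interior_closedBall (Metric.mem_ball_self (by positivity))⟩
  have hsub : {x | s < maxBall g x} ⊆
      ⋃ a ∈ u, Metric.closedBall a.1 (4 * (2 : ℝ) ^ (-a.2)) := by
    intro x hx
    obtain ⟨j, hj⟩ := lt_iSup_iff.1 (show s < maxBall g x from hx)
    obtain ⟨b, hb, hb'⟩ := hcov (x, j) hj
    exact mem_biUnion hb (hb' (Metric.mem_closedBall_self (by positivity)))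
  have hvol : ∀ a : Rn n × ℤ, volume (Metric.closedBall a.1 (4 * (2 : ℝ) ^ (-a.2))) =
      4 ^ n * v * 2 ^ (-((a.2 : ℝ) * n)) := fun a => by
    rw [Measure.addHaar_closedBall _ _ (by positivity), finrank_euclideanSpace_fin, mul_pow,
      ENNReal.ofReal_mul (by positivity), ofReal_two_zpow_neg_pow, ENNReal.ofReal_pow (by norm_num)]
    simp only [ENNReal.ofReal_ofNat]
    ring
  calc s * volume {x | s < maxBall g x}
      ≤ s * ∑' a : u, volume (Metric.closedBall a.1.1 (4 * (2 : ℝ) ^ (-a.1.2))) := by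
        gcongr
        exact (measure_mono hsub).trans (measure_biUnion_le _ hcount _)
    _ = 4 ^ n * v * ∑' a : u, s * 2 ^ (-((a.1.2 : ℝ) * n)) := by
        rw [← ENNReal.tsum_mul_left, ← ENNReal.tsum_mul_left]
        congr with a
        rw [hvol]; ring
    _ ≤ 4 ^ n * v * ∑' a : u, ∫⁻ y in Metric.closedBall a.1.1 ((2 : ℝ) ^ (-a.1.2)), g y := by
        gcongr with a
        exact hbound a.1 (hut a.2)
    _ = 4 ^ n * v * ∫⁻ y in ⋃ a ∈ u, Metric.closedBall a.1 ((2 : ℝ) ^ (-a.2)), g y := by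
        rw [lintegral_biUnion hcount (fun a _ => measurableSet_closedBall) hdisj]
    _ ≤ _ := by gcongr; exact setLIntegral_le_lintegral _ _

/-- Truncation at height `c`. The bounded part contributes `c` times the volume of the unit ball,
because `maxBall` divides by `ρ ^ n` and not by the volume of the ball. -/
lemma maxBall_le_add (g : Rn n → ℝ≥0∞) (c : ℝ≥0∞) (x : Rn n) :
    maxBall g x ≤ maxBall ({x | c < g x}.indicator g) x +
      volume (Metric.ball (0 : Rn n) 1) * c := by
  refine iSup_le fun j => ?_
  have hle : ∀ y, g y ≤ {x | c < g x}.indicator g y + c := fun y => by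
    by_cases h : c < g y
    · rw [indicator_of_mem (show y ∈ {x | c < g x} from h)]; exact le_self_add
    · exact (not_lt.1 h).trans le_add_self
  calc _ ≤ 2 ^ ((j : ℝ) * n) * ∫⁻ y in Metric.closedBall x ((2 : ℝ) ^ (-j)),
        ({x | c < g x}.indicator g y + c) := by gcongr; exact hle _
    _ = 2 ^ ((j : ℝ) * n) * (∫⁻ y in Metric.closedBall x ((2 : ℝ) ^ (-j)),
        {x | c < g x}.indicator g y) + (2 ^ ((j : ℝ) * n) * 2 ^ (-((j : ℝ) * n))) *
        (volume (Metric.ball (0 : Rn n) 1) * c) := by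
        rw [lintegral_add_right _ measurable_const, setLIntegral_const,
          Measure.addHaar_closedBall _ _ (by positivity), finrank_euclideanSpace_fin,
          ofReal_two_zpow_neg_pow]
        ring
    _ ≤ _ := by
        rw [two_rpow_mul_two_rpow_neg, one_mul]
        gcongr
        exact le_iSup (fun j : ℤ => 2 ^ ((j : ℝ) * n) *
          ∫⁻ y in Metric.closedBall x ((2 : ℝ) ^ (-j)), {x | c < g x}.indicator g y) j

/-- The rearrangement of the maximal function is bounded by a dyadic average of the rearrangement
of the function. -/
lemma rearr_maxBall_le (hn : n ≠ 0) {g : Rn n → ℝ≥0∞} (hg : AEMeasurable g) {τ : ℝ≥0∞}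
    (hτ : τ ≠ ∞) :
    rearr (maxBall g) volume τ ≤ ((4 ^ n + 1) * volume (Metric.ball (0 : Rn n) 1)) *
      ∑' k : ℕ, 2⁻¹ ^ k * rearr g volume (2⁻¹ ^ (k + 1) * τ) := by
  set v := volume (Metric.ball (0 : Rn n) 1) with hv
  have hv0 : v ≠ 0 := (Metric.measure_ball_pos _ _ one_pos).ne'
  have hvt : v ≠ ∞ := measure_ball_lt_top.ne
  set c := rearr g volume τ with hc
  set h := {x | c < g x}.indicator g with hh
  set S := ∑' k : ℕ, 2⁻¹ ^ k * rearr g volume (2⁻¹ ^ (k + 1) * τ) with hS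
  have hI : ∫⁻ y, h y ≤ S * τ := by
    refine (lintegral_indicator_rearr_lt_le hg hτ).trans (le_of_eq ?_)
    rw [hS, ← ENNReal.tsum_mul_right]
    congr with k
    ring
  have hcS : c ≤ S := by
    refine le_trans ?_ (ENNReal.le_tsum 0)
    simp only [pow_zero, one_mul]
    refine rearr_antitone _ _ ?_
    calc 2⁻¹ ^ (0 + 1) * τ ≤ 1 * τ := by gcongr; simp
      _ = τ := one_mul _
  rcases eq_or_ne S ∞ with hSt | hSt
  · rw [hSt, ENNReal.mul_top (by simp [hv0])]; exact le_top
  -- The level at which the weak (1,1) inequality, with `∫ h ≤ S τ`, leaves a set of measure at most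
  -- `τ`. If `S = 0` the inequality says nothing, but then `maxBall h` vanishes.
  set s := 4 ^ n * v * S with hs
  have hst : s ≠ ∞ := ENNReal.mul_ne_top (ENNReal.mul_ne_top (by simp) hvt) hSt
  have hmeas : volume {x | s < maxBall h x} ≤ τ := by
    rcases eq_or_ne S 0 with hS0 | hS0
    · have hz : ∫⁻ y, h y = 0 := by simpa [hS0] using hI
      have : ∀ x, maxBall h x = 0 := fun x => by
        refine le_antisymm (iSup_le fun j => ?_) bot_le
        have := (setLIntegral_le_lintegral (Metric.closedBall x ((2 : ℝ) ^ (-j))) h).trans hz.le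
        rw [le_antisymm this bot_le, mul_zero]
      simp [this]
    · have hs0 : s ≠ 0 := by simp [hs, hv0, hS0]
      have h1 := (mul_volume_lt_maxBall_le hn h s).trans (mul_le_mul_right hI (4 ^ n * v))
      rw [← mul_assoc] at h1
      exact (ENNReal.mul_le_mul_iff_right hs0 hst).1 h1
  calc rearr (maxBall g) volume τ ≤ s + v * c := by
        refine rearr_le_of_distrib_le (le_trans (measure_mono fun x hx => ?_) hmeas)
        simp only [mem_ofPred_eq, enorm_eq_self] at hx ⊢
        refine lt_of_not_ge fun h2 => absurd hx (not_lt.2 ?_)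
        exact (maxBall_le_add g c x).trans (by gcongr)
    _ ≤ s + v * S := by gcongr
    _ = _ := by rw [hs]; ring

/-- The maximal operator is bounded on Lorentz spaces. -/
lemma exists_lorentzInt_maxBall_le (hn : n ≠ 0) {p q : ℝ} (hp : 1 < p) (hq : 0 < q) :
    ∃ C : ℝ≥0∞, C ≠ ∞ ∧ ∀ g : Rn n → ℝ≥0∞, AEMeasurable g →
      lorentzInt p q (rearr (maxBall g) volume) ≤ C * lorentzInt p q (rearr g volume) := by
  obtain ⟨C, hC, hle⟩ := exists_lorentzInt_hardy hp hq
  set A := (4 ^ n + 1) * volume (Metric.ball (0 : Rn n) 1) with hA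
  have hAt : A ≠ ∞ := ENNReal.mul_ne_top (by simp) measure_ball_lt_top.ne
  refine ⟨A ^ q * C, ENNReal.mul_ne_top (by simp [hAt, hq.le]) hC, fun g hg => ?_⟩
  calc _ ≤ lorentzInt p q (fun τ => A *
        ∑' k : ℕ, 2⁻¹ ^ k * rearr g volume (2⁻¹ ^ (k + 1) * τ)) :=
        lorentzInt_mono hq fun τ _ hτ => rearr_maxBall_le hn hg hτ
    _ = A ^ q * lorentzInt p q (fun τ =>
        ∑' k : ℕ, 2⁻¹ ^ k * rearr g volume (2⁻¹ ^ (k + 1) * τ)) := lorentzInt_const_mul hq hAt _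
    _ ≤ A ^ q * (C * lorentzInt p q (rearr g volume)) := by
        gcongr; exact hle _ (measurable_rearr _ _)
    _ = _ := by ring

end Maximal

/-- Hölder's inequality for the Lorentz quasi-norm on a space of finite measure. -/
lemma exists_lintegral_le_lorentzInt {p q : ℝ} (hp : 1 < p) (hq : 0 < q) :
    ∃ C : ℝ≥0∞, C ≠ ∞ ∧ ∀ {X : Type} [MeasurableSpace X] {μ : Measure X} {g : X → ℝ≥0∞},
      AEMeasurable g μ → μ univ ≠ 0 → μ univ ≠ ∞ →
      ∫⁻ x, g x ∂μ ≤ C * μ univ ^ (1 - p⁻¹) * lorentzInt p q (rearr g μ) ^ q⁻¹ := by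
  have hp0 : 0 < p := by linarith
  have hp1 : p⁻¹ < 1 := inv_lt_one_of_one_lt₀ hp
  set S := ∑' k : ℕ, (2 : ℝ≥0∞) ^ (-((1 - p⁻¹) * k)) with hS
  have hSt : S ≠ ∞ := (tsum_two_rpow_neg_lt_top (by linarith)).ne
  set A : ℝ≥0∞ := (2 * 2 ^ (q / p)) ^ q⁻¹ with hA
  have hAt : A ≠ ∞ := by
    simp only [hA]
    exact ENNReal.rpow_ne_top_of_nonneg (by positivity) (ENNReal.mul_ne_top (by simp) (by simp))
  refine ⟨A * 2 ^ p⁻¹ * S, ENNReal.mul_ne_top (ENNReal.mul_ne_top hAt (by simp)) hSt,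
    fun {X} _ {μ} {g} hg h0 ht => ?_⟩
  set τ := μ univ with hτ
  set N := lorentzInt p q (rearr g μ) ^ q⁻¹ with hN
  -- At `τ = μ univ` the rearrangement vanishes, so the part of `g` above it is all of `g`. The weak
  -- bound `hpt` then makes the dyadic sum geometric with ratio `2^(-(1 - 1/p))`.
  have hr0 : rearr g μ τ = 0 := rearr_eq_zero_of_measure_le g le_rfl
  have hpt : ∀ σ : ℝ≥0∞, σ ≠ 0 → σ ≠ ∞ → rearr g μ σ ≤ σ ^ (-p⁻¹) * (A * N) := by
    intro σ hσ hσt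
    have h1 := rpow_mul_le_lorentzInt hp0 hq (rearr_antitone g μ) hσ hσt
    have h2 : σ ^ p⁻¹ * rearr g μ σ ≤ A * N := by
      rw [hA, hN, ← ENNReal.mul_rpow_of_nonneg _ _ (by positivity)]
      rwa [← ENNReal.rpow_le_rpow_iff hq, ENNReal.rpow_inv_rpow hq.ne']
    calc rearr g μ σ = σ ^ (-p⁻¹) * (σ ^ p⁻¹ * rearr g μ σ) := by
          rw [← mul_assoc, ← ENNReal.rpow_add _ _ hσ hσt]; simp
      _ ≤ _ := by gcongr
  have hind : {x | rearr g μ τ < g x}.indicator g = g := by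
    rw [hr0]
    ext x
    rcases eq_or_ne (g x) 0 with h | h
    · simp [indicator, h]
    · rw [indicator_of_mem]
      exact pos_iff_ne_zero.2 h
  have h3 := lintegral_indicator_rearr_lt_le hg ht
  rw [hind] at h3
  calc _ ≤ _ := h3
    _ ≤ ∑' k : ℕ, A * 2 ^ p⁻¹ * 2 ^ (-((1 - p⁻¹) * k)) * τ ^ (1 - p⁻¹) * N := by
        refine ENNReal.tsum_le_tsum fun k => ?_
        have hw : (2⁻¹ : ℝ≥0∞) ^ (k + 1) * τ ≠ 0 := mul_ne_zero (by simp) h0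
        have hwt : (2⁻¹ : ℝ≥0∞) ^ (k + 1) * τ ≠ ∞ := ENNReal.mul_ne_top (by simp) ht
        have e1 : ∀ i : ℕ, (2⁻¹ : ℝ≥0∞) ^ i = 2 ^ (-(i : ℝ)) := fun i => by
          rw [← ENNReal.rpow_natCast, ENNReal.inv_rpow, ENNReal.rpow_neg]
        calc _ ≤ ((2⁻¹ ^ (k + 1) * τ) ^ (-p⁻¹) * (A * N)) * (2⁻¹ ^ k * τ) := by
              gcongr; exact hpt _ hw hwt
          _ = ((2 ^ (-((k + 1 : ℕ) : ℝ))) ^ (-p⁻¹) * 2 ^ (-(k : ℝ))) * (τ ^ (-p⁻¹) * τ) * (A * N) := by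
              rw [ENNReal.mul_rpow_of_ne_top (by simp) ht, e1, e1]; ring
          _ = (2 ^ p⁻¹ * 2 ^ (-((1 - p⁻¹) * k))) * (τ ^ (1 - p⁻¹)) * (A * N) := by
              congr 2
              · rw [← ENNReal.rpow_mul, ← ENNReal.rpow_add _ _ (by simp) (by simp),
                  ← ENNReal.rpow_add _ _ (by simp) (by simp)]
                congr 1; push_cast; ring
              · nth_rw 2 [← ENNReal.rpow_one τ]
                rw [← ENNReal.rpow_add _ _ h0 ht]; congr 1; ring
          _ = _ := by ring
    _ = _ := by
        rw [ENNReal.tsum_mul_right, ENNReal.tsum_mul_right, ENNReal.tsum_mul_left]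

/-! ### Dyadic cubes, their neighbours and ancestors, and the local maximal estimate. -/

section Dyadic

variable {n : ℕ}

lemma dyadicCube_eq_preimage (j : ℤ) (m : Fin n → ℤ) : dyadicCube j m =
    WithLp.ofLp ⁻¹' (univ.pi fun i => Ico ((2 : ℝ) ^ (-j) * m i) ((2 : ℝ) ^ (-j) * (m i + 1))) := by
  ext x; simp [dyadicCube]

lemma measurableSet_dyadicCube (j : ℤ) (m : Fin n → ℤ) : MeasurableSet (dyadicCube j m) := by
  rw [dyadicCube_eq_preimage]
  exact (MeasurableSet.univ_pi fun i => measurableSet_Ico).preimage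
    (PiLp.volume_preserving_ofLp (Fin n)).measurable

lemma volume_dyadicCube (j : ℤ) (m : Fin n → ℤ) :
    volume (dyadicCube j m) = 2 ^ (-((j : ℝ) * n)) := by
  rw [dyadicCube_eq_preimage, (PiLp.volume_preserving_ofLp (Fin n)).measure_preimage
    (MeasurableSet.univ_pi fun i => measurableSet_Ico).nullMeasurableSet, Real.volume_pi_Ico,
    ← ofReal_two_zpow_neg_pow]
  have : ∀ i, (2 : ℝ) ^ (-j) * (m i + 1) - (2 : ℝ) ^ (-j) * m i = (2 : ℝ) ^ (-j) := fun i => by ring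
  simp only [this, Finset.prod_const, Finset.card_univ, Fintype.card_fin]
  rw [ENNReal.ofReal_pow (by positivity)]

lemma exists_mem_dyadicCube (j : ℤ) (x : Rn n) : ∃ m, x ∈ dyadicCube j m := by
  refine ⟨fun i => ⌊(2 : ℝ) ^ j * x i⌋, fun i => ?_⟩
  have h2 : (0 : ℝ) < 2 ^ j := by positivity
  rw [zpow_neg]
  constructor
  · rw [inv_mul_le_iff₀ h2]; exact Int.floor_le _
  · rw [lt_inv_mul_iff₀ h2]; exact Int.lt_floor_add_one _

/-- The indices of the `3 ^ n` dyadic cubes of the same generation which touch a given one. -/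
def nbr (m : Fin n → ℤ) (e : Fin n → Fin 3) : Fin n → ℤ := fun i => m i + (e i : ℕ) - 1

/-- The index of the `k`-th dyadic ancestor. -/
def anc (k : ℕ) (m : Fin n → ℤ) : Fin n → ℤ := fun i => m i / 2 ^ k

lemma anc_zero (m : Fin n → ℤ) : anc 0 m = m := by ext i; simp [anc]

lemma mem_dyadicCube_anc {j : ℤ} {m : Fin n → ℤ} {x : Rn n} (hx : x ∈ dyadicCube j m) (k : ℕ) :
    x ∈ dyadicCube (j - k) (anc k m) := by
  intro i
  have h2 : (0 : ℝ) < 2 ^ (-j) := by positivity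
  have he : (2 : ℝ) ^ (-(j - (k : ℤ))) = 2 ^ (-j) * 2 ^ k := by
    rw [show -(j - (k : ℤ)) = -j + k by ring, zpow_add₀ two_ne_zero, zpow_natCast]
  have h3 : (m i / 2 ^ k) * 2 ^ k ≤ m i := Int.ediv_mul_le _ (by positivity)
  have h4 : m i + 1 ≤ (m i / 2 ^ k + 1) * 2 ^ k := Int.lt_ediv_add_one_mul_self _ (by positivity)
  have h3' : ((m i / 2 ^ k : ℤ) : ℝ) * 2 ^ k ≤ m i := by exact_mod_cast h3
  have h4' : (m i : ℝ) + 1 ≤ (((m i / 2 ^ k : ℤ) : ℝ) + 1) * 2 ^ k := by exact_mod_cast h4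
  obtain ⟨ha, hb⟩ := hx i
  rw [he]
  constructor
  · refine le_trans ?_ ha
    rw [mul_assoc]
    exact mul_le_mul_of_nonneg_left (by rw [mul_comm]; exact h3') h2.le
  · refine lt_of_lt_of_le hb ?_
    rw [mul_assoc]
    exact mul_le_mul_of_nonneg_left (by rw [mul_comm]; exact h4') h2.le

/-- The radius equals the side of the cube, so each coordinate leaves its interval by at most one
step. -/
lemma closedBall_subset_iUnion_nbr {j : ℤ} {m : Fin n → ℤ} {x : Rn n} (hx : x ∈ dyadicCube j m) :
    Metric.closedBall x ((2 : ℝ) ^ (-j)) ⊆ ⋃ e, dyadicCube j (nbr m e) := by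
  intro y hy
  have hc : ∀ i, |y i - x i| ≤ (2 : ℝ) ^ (-j) := fun i => by
    have := PiLp.norm_apply_le (y - x) i
    rw [Metric.mem_closedBall, dist_eq_norm] at hy
    simpa using this.trans hy
  have key : ∀ i, ∃ e : Fin 3, (2 : ℝ) ^ (-j) * ((m i + (e : ℕ) - 1 : ℤ) : ℝ) ≤ y i ∧
      y i < (2 : ℝ) ^ (-j) * (((m i + (e : ℕ) - 1 : ℤ) : ℝ) + 1) := fun i => by
    have h := abs_le.1 (hc i)
    obtain ⟨ha, hb⟩ := hx i
    set w := (2 : ℝ) ^ (-j)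
    by_cases h1 : y i < w * m i
    · refine ⟨0, ?_, ?_⟩ <;> push_cast <;> simp <;> linarith
    · by_cases h2 : y i < w * (m i + 1)
      · refine ⟨1, ?_, ?_⟩ <;> push_cast <;> simp <;> linarith
      · refine ⟨2, ?_, ?_⟩ <;> push_cast <;> simp <;> linarith
  choose e he using key
  exact mem_iUnion.2 ⟨e, fun i => he i⟩

lemma setLIntegral_closedBall_le {j : ℤ} {m : Fin n → ℤ} {x : Rn n} (hx : x ∈ dyadicCube j m)
    (g : Rn n → ℝ≥0∞) : ∫⁻ y in Metric.closedBall x ((2 : ℝ) ^ (-j)), g y ≤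
      ∑ e, ∫⁻ y in dyadicCube j (nbr m e), g y := by
  refine (lintegral_mono_set (closedBall_subset_iUnion_nbr hx)).trans ?_
  rw [← tsum_fintype (L := SummationFilter.unconditional _)]
  exact lintegral_iUnion_le _ _

lemma localTerm_eq {ε : Type*} [ENorm ε] (f : Rn n → ε) {p q t : ℝ} (hp : 0 < p) (hq : 0 < q)
    (ht : 0 < t) (j : ℤ) (m : Fin n → ℤ) :
    localTerm f (ENNReal.ofReal p) (ENNReal.ofReal q) (ENNReal.ofReal t) (j, m) =
      2 ^ (-((j : ℝ) * n) * (t⁻¹ - p⁻¹)) *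
        lorentzInt p q (rearr f (volume.restrict (dyadicCube j m))) ^ q⁻¹ := by
  rw [localTerm, lorentzNorm_eq _ _ hp hq, volume_dyadicCube, ENNReal.toReal_ofReal hp.le,
    ENNReal.toReal_ofReal ht.le, ENNReal.rpow_mul]

/-- Averages over dyadic cubes are bounded by the local terms. -/
lemma exists_average_le_localTerm {p q t : ℝ} (hp : 1 < p) (hq : 0 < q) (ht : 0 < t) :
    ∃ C : ℝ≥0∞, C ≠ ∞ ∧ ∀ g : Rn n → ℝ≥0∞, AEMeasurable g → ∀ (j : ℤ) (m : Fin n → ℤ),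
      2 ^ ((j : ℝ) * n) * ∫⁻ y in dyadicCube j m, g y ≤ C * 2 ^ ((j : ℝ) * n * t⁻¹) *
        localTerm g (ENNReal.ofReal p) (ENNReal.ofReal q) (ENNReal.ofReal t) (j, m) := by
  obtain ⟨C, hC, h⟩ := exists_lintegral_le_lorentzInt hp hq
  refine ⟨C, hC, fun g hg j m => ?_⟩
  have h1 := h (hg.restrict (s := dyadicCube j m)) (by simp [volume_dyadicCube])
    (by simp [volume_dyadicCube])
  rw [Measure.restrict_apply_univ, volume_dyadicCube] at h1
  rw [localTerm_eq _ (by linarith) hq ht]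
  set N := lorentzInt p q (rearr g (volume.restrict (dyadicCube j m))) ^ q⁻¹
  calc _ ≤ 2 ^ ((j : ℝ) * n) * (C * (2 ^ (-((j : ℝ) * n))) ^ (1 - p⁻¹) * N) := by gcongr
    _ = C * (2 ^ ((j : ℝ) * n) * 2 ^ (-((j : ℝ) * n) * (1 - p⁻¹))) * N := by
        rw [← ENNReal.rpow_mul]; ring
    _ = C * (2 ^ ((j : ℝ) * n * t⁻¹) * 2 ^ (-((j : ℝ) * n) * (t⁻¹ - p⁻¹))) * N := by
        rw [← ENNReal.rpow_add _ _ (by simp) (by simp), ← ENNReal.rpow_add _ _ (by simp) (by simp)]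
        congr 3; ring
    _ = _ := by ring

/-- Balls of radius at most the side of the cube stay among its neighbours. A larger dyadic radius
is the side of an ancestor, whose neighbours cover the ball; the resulting bound does not depend on
the position of `x` in the cube. -/
lemma maxBall_le_max {j : ℤ} {m : Fin n → ℤ} {x : Rn n} (hx : x ∈ dyadicCube j m)
    (g : Rn n → ℝ≥0∞) :
    maxBall g x ≤ max (maxBall ((⋃ e, dyadicCube j (nbr m e)).indicator g) x)
      (⨆ k : ℕ, ∑ e, 2 ^ (((j - k : ℤ) : ℝ) * n) *
        ∫⁻ y in dyadicCube (j - k) (nbr (anc k m) e), g y) := by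
  refine iSup_le fun i => ?_
  rcases le_total j i with hij | hij
  · refine le_trans (le_trans (le_of_eq ?_) (le_iSup (fun i : ℤ => 2 ^ ((i : ℝ) * n) *
      ∫⁻ y in Metric.closedBall x ((2 : ℝ) ^ (-i)),
        (⋃ e, dyadicCube j (nbr m e)).indicator g y) i)) (le_max_left _ _)
    congr 1
    refine setLIntegral_congr_fun measurableSet_closedBall fun y hy => ?_
    rw [indicator_of_mem]
    refine closedBall_subset_iUnion_nbr hx (Metric.closedBall_subset_closedBall ?_ hy)
    exact zpow_le_zpow_right₀ one_le_two (by omega)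
  · obtain ⟨k, rfl⟩ : ∃ k : ℕ, i = j - k := ⟨(j - i).toNat, by omega⟩
    refine le_trans ?_ (le_max_right _ _)
    refine le_trans ?_ (le_iSup _ k)
    rw [← Finset.mul_sum]
    gcongr
    exact setLIntegral_closedBall_le (mem_dyadicCube_anc hx k) g

/-- With `N` pieces, above the largest of the local rearrangements at `τ / N` each piece contributes
measure at most `τ / N`; the dilation by `N` costs `N ^ (q / p)`. -/
lemma lorentzInt_rearr_indicator_iUnion_le {p q : ℝ} (hq : 0 < q) {ι : Type*} [Fintype ι]
    [Nonempty ι] {X : Type*} [MeasurableSpace X] {μ : Measure X} {s : ι → Set X}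
    (hs : ∀ i, MeasurableSet (s i)) (g : X → ℝ≥0∞) :
    lorentzInt p q (rearr ((⋃ i, s i).indicator g) μ) ≤
      (Fintype.card ι : ℝ≥0∞) ^ (q / p) * ∑ i, lorentzInt p q (rearr g (μ.restrict (s i))) := by
  have hN0 : (Fintype.card ι : ℝ≥0∞) ≠ 0 := by simp
  have hNt : (Fintype.card ι : ℝ≥0∞) ≠ ∞ := by simp
  set N : ℝ≥0∞ := (Fintype.card ι : ℝ≥0∞) with hN
  have h1 : ∀ τ, rearr ((⋃ i, s i).indicator g) μ τ ≤
      ⨆ i, rearr g (μ.restrict (s i)) (N⁻¹ * τ) := by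
    intro τ
    refine rearr_le_of_distrib_le ?_
    set c := ⨆ i, rearr g (μ.restrict (s i)) (N⁻¹ * τ)
    have hsub : {x | c < ‖(⋃ i, s i).indicator g x‖ₑ} ⊆ ⋃ i, ({x | c < ‖g x‖ₑ} ∩ s i) := by
      intro x hx
      simp only [mem_ofPred_eq, enorm_eq_self] at hx
      have hmem : x ∈ ⋃ i, s i := by
        by_contra h
        rw [indicator_of_notMem h] at hx
        exact absurd hx (not_lt.2 bot_le)
      rw [indicator_of_mem hmem] at hx
      obtain ⟨i, hi⟩ := mem_iUnion.1 hmem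
      exact mem_iUnion.2 ⟨i, by simpa using hx, hi⟩
    calc _ ≤ ∑ i, μ ({x | c < ‖g x‖ₑ} ∩ s i) :=
          (measure_mono hsub).trans (measure_iUnion_fintype_le _ _)
      _ ≤ ∑ i : ι, N⁻¹ * τ := by
          refine Finset.sum_le_sum fun i _ => ?_
          rw [← Measure.restrict_apply' (hs i)]
          refine le_trans ?_ (distrib_rearr_le g (μ.restrict (s i)) (N⁻¹ * τ))
          exact distrib_antitone g (μ.restrict (s i))
            (le_iSup (fun i => rearr g (μ.restrict (s i)) (N⁻¹ * τ)) i)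
      _ = τ := by
          rw [Finset.sum_const, nsmul_eq_mul, Finset.card_univ, ← hN, ← mul_assoc,
            ENNReal.mul_inv_cancel hN0 hNt, one_mul]
  calc _ ≤ ∑' i, lorentzInt p q (fun τ => rearr g (μ.restrict (s i)) (N⁻¹ * τ)) :=
        lorentzInt_le_tsum_of_le_iSup hq
          (fun i => (measurable_rearr _ _).comp (measurable_id.const_mul _)) fun τ _ _ => h1 τ
    _ = _ := by
        rw [tsum_fintype, Finset.mul_sum]
        refine Finset.sum_congr rfl fun i _ => ?_
        rw [lorentzInt_comp_mul hq (by simpa using hNt) (by simpa using hN0), inv_inv]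

/-- The local estimate for the maximal function on a dyadic cube, in terms of the cubes touching
its ancestors. -/
lemma exists_localTerm_maxBall_le (hn : n ≠ 0) {p q t : ℝ} (hp : 1 < p) (hq : 0 < q) (ht : 0 < t) :
    ∃ C : ℝ≥0∞, C ≠ ∞ ∧ ∀ g : Rn n → ℝ≥0∞, AEMeasurable g → ∀ (j : ℤ) (m : Fin n → ℤ),
      localTerm (maxBall g) (ENNReal.ofReal p) (ENNReal.ofReal q) (ENNReal.ofReal t) (j, m) ≤
        C * ⨆ k : ℕ, 2 ^ (-(n * t⁻¹ * k)) * ∑ e, localTerm g (ENNReal.ofReal p)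
          (ENNReal.ofReal q) (ENNReal.ofReal t) (j - k, nbr (anc k m) e) := by
  have hp0 : 0 < p := by linarith
  obtain ⟨CM, hCM, hM⟩ := exists_lorentzInt_maxBall_le hn hp hq
  obtain ⟨CH, hCH, hH⟩ := exists_average_le_localTerm (n := n) hp hq ht
  set c := lorentzInt p q ((Iio 1).indicator fun _ => 1) with hc
  have hct : c ≠ ∞ := (lorentzInt_indicator_lt_top hp0 hq).ne
  set E : ℝ≥0∞ := (Fintype.card (Fin n → Fin 3) : ℝ≥0∞) with hE
  have hEt : E ≠ ∞ := by simp [hE]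
  set K := 2 ^ q * (CM * (E ^ (q / p) * E) + CH ^ q * c) with hK
  have hKt : K ≠ ∞ := ENNReal.mul_ne_top (by simp) (ENNReal.add_ne_top.2
    ⟨ENNReal.mul_ne_top hCM (ENNReal.mul_ne_top
      (ENNReal.rpow_ne_top_of_nonneg (by positivity) hEt) hEt),
    ENNReal.mul_ne_top (ENNReal.rpow_ne_top_of_nonneg hq.le hCH) hct⟩)
  refine ⟨K ^ q⁻¹, ENNReal.rpow_ne_top_of_nonneg (by positivity) hKt, fun g hg j m => ?_⟩
  set loc := localTerm g (ENNReal.ofReal p) (ENNReal.ofReal q) (ENNReal.ofReal t) with hloc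
  set B := ⨆ k : ℕ, 2 ^ (-(n * t⁻¹ * k)) * ∑ e, loc (j - k, nbr (anc k m) e) with hB
  set T := ⨆ k : ℕ, ∑ e, 2 ^ (((j - k : ℤ) : ℝ) * n) *
        ∫⁻ y in dyadicCube (j - k) (nbr (anc k m) e), g y with hT
  set U := ⋃ e, dyadicCube j (nbr m e) with hU
  set Q := dyadicCube j m with hQ
  set W : ℝ≥0∞ := 2 ^ (-((j : ℝ) * n) * (t⁻¹ - p⁻¹)) with hW
  set V : ℝ≥0∞ := 2 ^ (-((j : ℝ) * n)) with hV
  have hVQ : volume Q = V := volume_dyadicCube j m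
  -- On the cube the far part is bounded by the constant `T`, whose rearrangement is `T` on `[0,
  -- |Q|)` and zero afterwards.
  have hrearr : ∀ τ, rearr (maxBall g) (volume.restrict Q) τ ≤
      rearr (maxBall (U.indicator g)) volume τ + (Iio V).indicator (fun _ => T) τ := by
    intro τ
    by_cases hτ : τ < V
    · rw [indicator_of_mem (show τ ∈ Iio V from hτ)]
      refine rearr_le_of_distrib_le ?_
      refine le_trans ?_ (distrib_rearr_le (maxBall (U.indicator g)) volume τ)
      rw [distrib, Measure.restrict_apply' (measurableSet_dyadicCube j m)]
      refine measure_mono ?_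
      rintro x ⟨hx, hxQ⟩
      simp only [mem_ofPred_eq, enorm_eq_self] at hx ⊢
      rcases le_max_iff.1 (maxBall_le_max hxQ g) with h | h
      · exact lt_of_lt_of_le (lt_of_le_of_lt le_self_add hx) h
      · exact absurd (lt_of_lt_of_le hx h) (not_lt.2 le_add_self)
    · rw [rearr_eq_zero_of_measure_le _ (by
        rw [Measure.restrict_apply_univ, hVQ]; exact not_lt.1 hτ)]
      exact bot_le
  have hL : lorentzInt p q (rearr (maxBall g) (volume.restrict Q)) ≤
      2 ^ q * (CM * (E ^ (q / p) *
        ∑ e, lorentzInt p q (rearr g (volume.restrict (dyadicCube j (nbr m e))))) +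
        T ^ q * V ^ (q / p) * c) := by
    calc _ ≤ _ := lorentzInt_mono hq fun τ _ _ => hrearr τ
      _ ≤ _ := lorentzInt_add_le hq (measurable_rearr _ _)
          (measurable_const.indicator measurableSet_Iio)
      _ ≤ _ := by
          rw [lorentzInt_indicator_Iio hq (by simp [hV]) (by simp [hV])]
          gcongr
          refine (hM _ (hg.indicator ?_)).trans ?_
          · exact MeasurableSet.iUnion fun e => measurableSet_dyadicCube _ _
          · gcongr
            exact lorentzInt_rearr_indicator_iUnion_le hq
              (fun e => measurableSet_dyadicCube _ _) g
  have hD : ∀ e, W ^ q * lorentzInt p q (rearr g (volume.restrict (dyadicCube j (nbr m e)))) ≤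
      B ^ q := by
    intro e
    have h1 : loc (j, nbr m e) ≤ B := by
      refine le_trans ?_ (le_iSup _ 0)
      simp only [Nat.cast_zero, mul_zero, neg_zero, ENNReal.rpow_zero, one_mul, sub_zero, anc_zero]
      exact Finset.single_le_sum (f := fun e => loc (j, nbr m e)) (fun _ _ => bot_le)
        (Finset.mem_univ e)
    rw [hloc, localTerm_eq g hp0 hq ht] at h1
    calc _ = (W * lorentzInt p q
          (rearr g (volume.restrict (dyadicCube j (nbr m e)))) ^ q⁻¹) ^ q := by
          rw [ENNReal.mul_rpow_of_nonneg _ _ hq.le, ENNReal.rpow_inv_rpow hq.ne']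
      _ ≤ _ := by gcongr
  -- Here `W * V ^ p⁻¹ = |Q|^(1/t) = 2^(-jn/t)`, while an average at generation `j - k` costs
  -- `2^((j-k)n/t)`; the quotient is the decay `2^(-nk/t)`.
  have hTB : W * V ^ p⁻¹ * T ≤ CH * B := by
    rw [hT, ENNReal.mul_iSup]
    refine iSup_le fun k => ?_
    calc _ ≤ W * V ^ p⁻¹ * ∑ e, CH * 2 ^ (((j - k : ℤ) : ℝ) * n * t⁻¹) *
          loc (j - k, nbr (anc k m) e) := by
          exact mul_le_mul_right (Finset.sum_le_sum fun e _ => hH g hg _ _) _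
      _ = CH * (2 ^ (-((j : ℝ) * n) * (t⁻¹ - p⁻¹)) * 2 ^ (-((j : ℝ) * n) * p⁻¹) *
          2 ^ (((j - k : ℤ) : ℝ) * n * t⁻¹) * ∑ e, loc (j - k, nbr (anc k m) e)) := by
          rw [← Finset.mul_sum, hW, hV, ← ENNReal.rpow_mul]; ring
      _ = CH * (2 ^ (-(n * t⁻¹ * k)) * ∑ e, loc (j - k, nbr (anc k m) e)) := by
          rw [← ENNReal.rpow_add _ _ (by simp) (by simp),
            ← ENNReal.rpow_add _ _ (by simp) (by simp)]
          congr 3; push_cast; ring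
      _ ≤ _ := by gcongr; exact le_iSup (fun k : ℕ => (2 : ℝ≥0∞) ^ (-(n * t⁻¹ * k)) *
          ∑ e, loc (j - k, nbr (anc k m) e)) k
  rw [localTerm_eq _ hp0 hq ht, ← ENNReal.rpow_le_rpow_iff hq,
    ENNReal.mul_rpow_of_nonneg _ _ hq.le, ENNReal.mul_rpow_of_nonneg _ _ hq.le,
    ENNReal.rpow_inv_rpow hq.ne', ENNReal.rpow_inv_rpow hq.ne']
  calc _ ≤ W ^ q * (2 ^ q * (CM * (E ^ (q / p) *
        ∑ e, lorentzInt p q (rearr g (volume.restrict (dyadicCube j (nbr m e))))) +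
        T ^ q * V ^ (q / p) * c)) := by gcongr
    _ = 2 ^ q * (CM * (E ^ (q / p) *
        ∑ e, W ^ q * lorentzInt p q (rearr g (volume.restrict (dyadicCube j (nbr m e))))) +
        (W * V ^ p⁻¹ * T) ^ q * c) := by
        rw [ENNReal.mul_rpow_of_nonneg _ _ hq.le, ENNReal.mul_rpow_of_nonneg _ _ hq.le,
          ← ENNReal.rpow_mul V, show p⁻¹ * q = q / p by ring, ← Finset.mul_sum]
        ring
    _ ≤ 2 ^ q * (CM * (E ^ (q / p) * ∑ e : Fin n → Fin 3, B ^ q) + (CH * B) ^ q * c) := by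
        gcongr with e; exact hD e
    _ = K * B ^ q := by
        rw [Finset.sum_const, nsmul_eq_mul, Finset.card_univ, ← hE,
          ENNReal.mul_rpow_of_nonneg _ _ hq.le, hK]
        ring

end Dyadic

/-! ### Summation over all dyadic cubes. -/

section

variable {n : ℕ}

/-- Division with remainder by `2 ^ k` in each coordinate shows that every fibre of `anc k` has `2 ^
(nk)` elements. -/
lemma tsum_comp_anc (k : ℕ) (F : (Fin n → ℤ) → ℝ≥0∞) :
    ∑' m, F (anc k m) = 2 ^ ((n : ℝ) * k) * ∑' m, F m := by
  let E : (Fin n → ℤ) ≃ (Fin n → ℤ) × (Fin n → Fin (2 ^ k)) :=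
    (Equiv.piCongrRight fun _ => Int.divModEquiv (2 ^ k)).trans
      (Equiv.arrowProdEquivProdArrow (Fin n) (fun _ => ℤ) (fun _ => Fin (2 ^ k)))
  have hE : ∀ m, (E m).1 = anc k m := fun m => by
    ext i
    simp [E, anc, Int.divModEquiv, Equiv.arrowProdEquivProdArrow]
  calc ∑' m, F (anc k m) = ∑' m, (fun z : (Fin n → ℤ) × (Fin n → Fin (2 ^ k)) => F z.1) (E m) := by
        simp [hE]
    _ = ∑' z : (Fin n → ℤ) × (Fin n → Fin (2 ^ k)), F z.1 :=
        E.tsum_eq (fun z : (Fin n → ℤ) × (Fin n → Fin (2 ^ k)) => F z.1)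
    _ = ∑' (m : Fin n → ℤ) (_ : Fin n → Fin (2 ^ k)), F m :=
        ENNReal.tsum_prod (f := fun m (_ : Fin n → Fin (2 ^ k)) => F m)
    _ = ∑' m : Fin n → ℤ, 2 ^ ((n : ℝ) * k) * F m := by
        congr with m
        rw [tsum_fintype, Finset.sum_const, nsmul_eq_mul]
        congr 1
        simp only [Finset.card_univ, Fintype.card_pi, Fintype.card_fin, Finset.prod_const]
        push_cast
        rw [← pow_mul, ← ENNReal.rpow_natCast]
        congr 1; push_cast; ring
    _ = _ := ENNReal.tsum_mul_left

lemma tsum_comp_nbr (e : Fin n → Fin 3) (F : (Fin n → ℤ) → ℝ≥0∞) :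
    ∑' m, F (nbr m e) = ∑' m, F m := by
  have : ∀ m, nbr m e = Equiv.addRight (fun i => ((e i : ℕ) : ℤ) - 1) m := fun m => by
    ext i; simp [nbr]; ring
  simp only [this]
  exact (Equiv.addRight fun i => ((e i : ℕ) : ℤ) - 1).tsum_eq F

lemma tsum_comp_nbr_anc (k : ℕ) (e : Fin n → Fin 3) (b : ℤ × (Fin n → ℤ) → ℝ≥0∞) :
    ∑' z : ℤ × (Fin n → ℤ), b (z.1 - k, nbr (anc k z.2) e) =
      2 ^ ((n : ℝ) * k) * ∑' z, b z := by
  calc _ = ∑' (j : ℤ) (m : Fin n → ℤ), b (j - k, nbr (anc k m) e) :=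
        ENNReal.tsum_prod (f := fun (j : ℤ) (m : Fin n → ℤ) => b (j - k, nbr (anc k m) e))
    _ = ∑' (j : ℤ), 2 ^ ((n : ℝ) * k) * ∑' m : Fin n → ℤ, b (j - k, m) := by
        congr with j
        rw [tsum_comp_anc k fun m => b (j - k, nbr m e), tsum_comp_nbr e fun m => b (j - k, m)]
    _ = 2 ^ ((n : ℝ) * k) * ∑' (j : ℤ) (m : Fin n → ℤ), b (j, m) := by
        rw [ENNReal.tsum_mul_left]
        congr 1
        exact (Equiv.subRight (k : ℤ)).tsum_eq fun j => ∑' m : Fin n → ℤ, b (j, m)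
    _ = _ := by rw [← ENNReal.tsum_prod (f := fun (j : ℤ) (m : Fin n → ℤ) => b (j, m))]

lemma sum_rpow_le_card_rpow_mul {ι : Type*} [Fintype ι] {r : ℝ} (hr : 0 < r) (a : ι → ℝ≥0∞) :
    (∑ i, a i) ^ r ≤ (Fintype.card ι : ℝ≥0∞) ^ r * ∑ i, a i ^ r := by
  have h1 : ∑ i, a i ≤ Fintype.card ι * ⨆ i, a i := by
    rw [← nsmul_eq_mul, ← Finset.card_univ]
    exact Finset.sum_le_card_nsmul _ _ _ fun i _ => le_iSup a i
  calc _ ≤ (Fintype.card ι * ⨆ i, a i) ^ r := by gcongr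
    _ = (Fintype.card ι : ℝ≥0∞) ^ r * ⨆ i, a i ^ r := by
        rw [ENNReal.mul_rpow_of_nonneg _ _ hr.le]
        congr 1
        exact (ENNReal.orderIsoRpow r hr).map_iSup _
    _ ≤ _ := by
        gcongr
        exact iSup_le fun i => Finset.single_le_sum (f := fun i => a i ^ r)
          (fun _ _ => bot_le) (Finset.mem_univ i)

/-- After the `r`-th power the supremum over `k` is replaced by a sum. The multiplicity `2^(nk)` of
the `k`-th ancestors meets the weight `2^(-srk)`, and `n < s r` makes the series converge. For `s =
n / t` this condition is `t < r`. -/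
lemma exists_tsum_iSup_rpow_le {s r : ℝ} (hr : 0 < r) (hsr : n < s * r) :
    ∃ C : ℝ≥0∞, C ≠ ∞ ∧ ∀ a : ℤ × (Fin n → ℤ) → ℝ≥0∞,
      ∑' z : ℤ × (Fin n → ℤ), (⨆ k : ℕ, 2 ^ (-(s * k)) *
        ∑ e, a (z.1 - k, nbr (anc k z.2) e)) ^ r ≤ C * ∑' z, a z ^ r := by
  set E : ℝ≥0∞ := (Fintype.card (Fin n → Fin 3) : ℝ≥0∞) with hE
  have hEt : E ≠ ∞ := by simp [hE]
  set S := ∑' k : ℕ, (2 : ℝ≥0∞) ^ (-((s * r - n) * k)) with hS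
  have hSt : S ≠ ∞ := (tsum_two_rpow_neg_lt_top (by linarith)).ne
  refine ⟨S * (E ^ r * E), ENNReal.mul_ne_top hSt (ENNReal.mul_ne_top
    (ENNReal.rpow_ne_top_of_nonneg hr.le hEt) hEt), fun a => ?_⟩
  calc _ ≤ ∑' z : ℤ × (Fin n → ℤ), ∑' k : ℕ, 2 ^ (-(s * r * k)) * (E ^ r *
        ∑ e, a (z.1 - k, nbr (anc k z.2) e) ^ r) := by
        refine ENNReal.tsum_le_tsum fun z => ?_
        calc _ = ⨆ k : ℕ, (2 ^ (-(s * k)) * ∑ e, a (z.1 - k, nbr (anc k z.2) e)) ^ r :=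
              (ENNReal.orderIsoRpow r hr).map_iSup _
          _ ≤ ∑' k : ℕ, (2 ^ (-(s * k)) * ∑ e, a (z.1 - k, nbr (anc k z.2) e)) ^ r :=
              iSup_le fun k => ENNReal.le_tsum k
          _ ≤ _ := by
              refine ENNReal.tsum_le_tsum fun k => ?_
              rw [ENNReal.mul_rpow_of_nonneg _ _ hr.le, ← ENNReal.rpow_mul,
                show -(s * k) * r = -(s * r * k) by ring]
              gcongr
              exact sum_rpow_le_card_rpow_mul hr _
    _ = ∑' k : ℕ, 2 ^ (-(s * r * k)) * (E ^ r * ∑ e : Fin n → Fin 3,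
        2 ^ ((n : ℝ) * k) * ∑' z, a z ^ r) := by
        rw [ENNReal.tsum_comm]
        congr with k
        rw [ENNReal.tsum_mul_left, ENNReal.tsum_mul_left,
          Summable.tsum_finsetSum fun _ _ => ENNReal.summable]
        congr 3 with e
        exact tsum_comp_nbr_anc k e fun z => a z ^ r
    _ = ∑' k : ℕ, 2 ^ (-((s * r - n) * k)) * (E ^ r * E * ∑' z, a z ^ r) := by
        congr with k
        rw [Finset.sum_const, nsmul_eq_mul, Finset.card_univ, ← hE,
          show -((s * r - n) * k) = -(s * r * k) + n * k by ring,
          ENNReal.rpow_add _ _ (by simp) (by simp)]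
        ring
    _ = _ := by rw [ENNReal.tsum_mul_right]; ring

/-- The maximal operator is bounded on Bourgain-Morrey-Lorentz spaces. -/
lemma exists_bmlNorm_maxBall_le (hn : n ≠ 0) {p q t : ℝ} {r : ℝ≥0∞} (hp : 1 < p) (hq : 0 < q)
    (ht : 0 < t) (hr : ENNReal.ofReal t < r) :
    ∃ C : ℝ≥0∞, C ≠ ∞ ∧ ∀ g : Rn n → ℝ≥0∞, AEMeasurable g →
      bmlNorm (maxBall g) (ENNReal.ofReal p) (ENNReal.ofReal q) (ENNReal.ofReal t) r ≤
        C * bmlNorm g (ENNReal.ofReal p) (ENNReal.ofReal q) (ENNReal.ofReal t) r := by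
  obtain ⟨C, hC, hle⟩ := exists_localTerm_maxBall_le hn hp hq ht
  rcases eq_or_ne r ∞ with rfl | hrt
  · set E : ℝ≥0∞ := (Fintype.card (Fin n → Fin 3) : ℝ≥0∞) with hE
    refine ⟨C * E, ENNReal.mul_ne_top hC (by simp [hE]), fun g hg => ?_⟩
    simp only [bmlNorm, if_true]
    refine iSup_le fun z => (hle g hg z.1 z.2).trans ?_
    rw [mul_assoc]
    gcongr
    refine iSup_le fun k => ?_
    calc _ ≤ 1 * ∑ e : Fin n → Fin 3, ⨆ z, localTerm g (ENNReal.ofReal p) (ENNReal.ofReal q)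
          (ENNReal.ofReal t) z := by
          gcongr with e
          · exact (ENNReal.rpow_le_rpow_of_exponent_le (by simp)
              (neg_nonpos.2 (by positivity))).trans_eq ENNReal.rpow_zero
          · exact le_iSup (localTerm g (ENNReal.ofReal p) (ENNReal.ofReal q) (ENNReal.ofReal t)) _
      _ = _ := by rw [one_mul, Finset.sum_const, nsmul_eq_mul, Finset.card_univ]
  · have htr : t < r.toReal := (ENNReal.ofReal_lt_iff_lt_toReal ht.le hrt).1 hr
    have hr0 : 0 < r.toReal := ht.trans htr
    have hn0 : (0 : ℝ) < n := by positivity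
    obtain ⟨D, hD, hle'⟩ := exists_tsum_iSup_rpow_le (n := n) (s := n * t⁻¹) hr0 (by
      rw [mul_assoc]
      exact lt_mul_of_one_lt_right hn0 (by rwa [inv_mul_eq_div, one_lt_div ht]))
    refine ⟨C * D ^ r.toReal⁻¹, ENNReal.mul_ne_top hC
      (ENNReal.rpow_ne_top_of_nonneg (by positivity) hD), fun g hg => ?_⟩
    simp only [bmlNorm, hrt, if_false]
    set loc := localTerm g (ENNReal.ofReal p) (ENNReal.ofReal q) (ENNReal.ofReal t)
    calc _ ≤ (∑' z : ℤ × (Fin n → ℤ), (C * ⨆ k : ℕ, 2 ^ (-(n * t⁻¹ * k)) *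
          ∑ e, loc (z.1 - k, nbr (anc k z.2) e)) ^ r.toReal) ^ r.toReal⁻¹ := by
          gcongr with z; exact hle g hg z.1 z.2
      _ = (C ^ r.toReal * ∑' z : ℤ × (Fin n → ℤ), (⨆ k : ℕ, 2 ^ (-(n * t⁻¹ * k)) *
          ∑ e, loc (z.1 - k, nbr (anc k z.2) e)) ^ r.toReal) ^ r.toReal⁻¹ := by
          rw [← ENNReal.tsum_mul_left]
          congr with z
          rw [ENNReal.mul_rpow_of_nonneg _ _ hr0.le]
      _ ≤ (C ^ r.toReal * (D * ∑' z, loc z ^ r.toReal)) ^ r.toReal⁻¹ := by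
          gcongr; exact hle' loc
      _ = _ := by
          rw [ENNReal.mul_rpow_of_nonneg _ _ (by positivity),
            ENNReal.mul_rpow_of_nonneg _ _ (by positivity), ENNReal.rpow_rpow_inv hr0.ne', mul_assoc]

end

/-! ### The fractional potential and Hedberg's inequality. -/

section

variable {n : ℕ}

/-- The fractional integral of a nonnegative function, with values in `[0, ∞]`. -/
def fracPotential (α : ℝ) (g : Rn n → ℝ≥0∞) (x : Rn n) : ℝ≥0∞ :=
  ∫⁻ y, ENNReal.ofReal (‖x - y‖ ^ ((n : ℝ) - α))⁻¹ * g y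

lemma fracPotential_le_tsum {α : ℝ} (hα : α < n) {g : Rn n → ℝ≥0∞} (hg : AEMeasurable g)
    (x : Rn n) : fracPotential α g x ≤ ∑' j : ℤ, 2 ^ (((j : ℝ) + 1) * (n - α)) *
      ∫⁻ y in Metric.closedBall x ((2 : ℝ) ^ (-j)), g y := by
  have hα' : 0 < (n : ℝ) - α := by linarith
  have hpt : ∀ y, ENNReal.ofReal (‖x - y‖ ^ ((n : ℝ) - α))⁻¹ * g y ≤
      ∑' j : ℤ, (Metric.closedBall x ((2 : ℝ) ^ (-j))).indicator
        (fun y => 2 ^ (((j : ℝ) + 1) * (n - α)) * g y) y := by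
    intro y
    -- On the diagonal the convention `0⁻¹ = 0` makes the kernel vanish; elsewhere the shell `2^i <
    -- |x - y| ≤ 2^(i+1)` corresponds to `j = -(i + 1)`.
    rcases eq_or_ne x y with rfl | hxy
    · simp [Real.zero_rpow hα'.ne']
    have hd : 0 < ‖x - y‖ := norm_pos_iff.2 (sub_ne_zero.2 hxy)
    obtain ⟨i, hi1, hi2⟩ := exists_mem_Ioc_zpow hd one_lt_two
    refine le_trans ?_ (ENNReal.le_tsum (-(i + 1)))
    rw [indicator_of_mem (by
      rw [Metric.mem_closedBall, dist_comm, dist_eq_norm, neg_neg]; exact hi2)]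
    gcongr
    have h2 : (0 : ℝ) < 2 ^ i := by positivity
    calc ENNReal.ofReal (‖x - y‖ ^ ((n : ℝ) - α))⁻¹ ≤
          ENNReal.ofReal (((2 : ℝ) ^ i) ^ ((n : ℝ) - α))⁻¹ := by
          gcongr
      _ = _ := by
          rw [← Real.rpow_neg h2.le, ← ENNReal.ofReal_rpow_of_pos h2, ofReal_two_zpow,
            ← ENNReal.rpow_mul]
          congr 1; push_cast; ring
  calc _ ≤ _ := lintegral_mono hpt
    _ = _ := by
        rw [lintegral_tsum fun j => (hg.const_mul _).indicator measurableSet_closedBall]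
        congr with j
        rw [lintegral_indicator measurableSet_closedBall, lintegral_const_mul' _ _ (by simp)]

/-- The bound `1` gives convergence as `j → ∞` since `a > 0`, and `2^(jb)` as `j → -∞` since `b >
a`. -/
lemma tsum_int_two_rpow_min_lt_top {a b : ℝ} (ha : 0 < a) (hab : a < b) :
    ∑' j : ℤ, (2 : ℝ≥0∞) ^ (-((j : ℝ) * a)) * min 1 (2 ^ ((j : ℝ) * b)) < ∞ := by
  rw [tsum_of_nat_of_neg_add_one ENNReal.summable ENNReal.summable, ENNReal.add_lt_top]
  constructor
  · refine lt_of_le_of_lt (ENNReal.tsum_le_tsum fun k => ?_) (tsum_two_rpow_neg_lt_top ha)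
    calc _ ≤ (2 : ℝ≥0∞) ^ (-(((k : ℤ) : ℝ) * a)) * 1 := by gcongr; exact min_le_left _ _
      _ = _ := by rw [mul_one, mul_comm a]; simp
  · refine lt_of_le_of_lt (ENNReal.tsum_le_tsum fun k => ?_)
      (tsum_two_rpow_neg_lt_top (sub_pos.2 hab))
    calc _ ≤ (2 : ℝ≥0∞) ^ (-(((-((k : ℤ) + 1) : ℤ) : ℝ) * a)) *
          2 ^ (((-((k : ℤ) + 1) : ℤ) : ℝ) * b) := by gcongr; exact min_le_right _ _
      _ = (2 : ℝ≥0∞) ^ (-((b - a) * ((k : ℝ) + 1))) := by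
          rw [← ENNReal.rpow_add _ _ (by simp) (by simp)]; congr 1; push_cast; ring
      _ ≤ _ := by
          refine ENNReal.rpow_le_rpow_of_exponent_le (by simp) ?_
          nlinarith

/-- The two bounds in the minimum cross near `2^(jb) = M / K`. Shifting `j` by the crossing index
reduces the sum to the case `M = K = 1`. -/
lemma exists_tsum_int_min_le {a b : ℝ} (ha : 0 < a) (hab : a < b) :
    ∃ C : ℝ≥0∞, C ≠ ∞ ∧ ∀ M K : ℝ≥0∞, K ≠ ∞ →
      ∑' j : ℤ, (2 : ℝ≥0∞) ^ (-((j : ℝ) * a)) * min M (2 ^ ((j : ℝ) * b) * K) ≤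
        C * (M ^ (1 - a / b) * K ^ (a / b)) := by
  set S := ∑' j : ℤ, (2 : ℝ≥0∞) ^ (-((j : ℝ) * a)) * min 1 (2 ^ ((j : ℝ) * b)) with hS
  have hSt : S ≠ ∞ := (tsum_int_two_rpow_min_lt_top ha hab).ne
  have hS0 : S ≠ 0 := by
    refine (lt_of_lt_of_le ?_ (ENNReal.le_tsum 0)).ne'
    simp
  have hb : 0 < b := ha.trans hab
  have hab1 : 0 < 1 - a / b := by rw [sub_pos, div_lt_one hb]; exact hab
  have hab0 : 0 < a / b := by positivity
  refine ⟨2 ^ a * S, ENNReal.mul_ne_top (by simp) hSt, fun M K hK => ?_⟩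
  rcases eq_or_ne K 0 with rfl | hK0
  · simp
  rcases eq_or_ne M 0 with rfl | hM0
  · simp
  rcases eq_or_ne M ∞ with rfl | hMt
  · rw [ENNReal.top_rpow_of_pos hab1, ENNReal.top_mul (by simp [hK0, hK]),
      ENNReal.mul_top (by simp [hS0])]
    exact le_top
  obtain ⟨i, hi1, hi2⟩ := ENNReal.exists_mem_Ico_zpow (x := M / K) (y := 2 ^ b)
    (by simp [hM0, hK]) (ENNReal.div_ne_top hMt hK0)
    (ENNReal.one_lt_rpow (by norm_num) hb) (by simp)
  rw [← ENNReal.rpow_intCast, ← ENNReal.rpow_mul] at hi1 hi2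
  have h1 : (2 : ℝ≥0∞) ^ (b * i) * K ≤ M :=
    (ENNReal.le_div_iff_mul_le (Or.inl hK0) (Or.inl hK)).1 hi1
  have h2 : (2 : ℝ≥0∞) ^ (-((i : ℝ) * a)) ≤ 2 ^ a * (M / K) ^ (-(a / b)) := by
    calc (2 : ℝ≥0∞) ^ (-((i : ℝ) * a))
        = 2 ^ a * (2 ^ (b * ((i + 1 : ℤ) : ℝ))) ^ (-(a / b)) := by
          rw [← ENNReal.rpow_mul, ← ENNReal.rpow_add _ _ (by simp) (by simp)]
          congr 1; push_cast; field_simp; ring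
      _ ≤ _ := by
          rw [ENNReal.rpow_neg, ENNReal.rpow_neg]
          gcongr
  calc _ = ∑' j : ℤ, (2 : ℝ≥0∞) ^ (-(((j + i : ℤ) : ℝ) * a)) *
        min M (2 ^ (((j + i : ℤ) : ℝ) * b) * K) :=
        ((Equiv.addRight i).tsum_eq fun j : ℤ => (2 : ℝ≥0∞) ^ (-((j : ℝ) * a)) *
          min M (2 ^ ((j : ℝ) * b) * K)).symm
    _ ≤ ∑' j : ℤ, 2 ^ (-((i : ℝ) * a)) * M * ((2 : ℝ≥0∞) ^ (-((j : ℝ) * a)) *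
        min 1 (2 ^ ((j : ℝ) * b))) := by
        refine ENNReal.tsum_le_tsum fun j => ?_
        calc _ = 2 ^ (-((i : ℝ) * a)) * 2 ^ (-((j : ℝ) * a)) *
              min M (2 ^ ((j : ℝ) * b) * (2 ^ (b * i) * K)) := by
              rw [← mul_assoc (2 ^ ((j : ℝ) * b)), ← ENNReal.rpow_add _ _ (by simp) (by simp),
                ← ENNReal.rpow_add _ _ (by simp) (by simp)]
              congr 4 <;> push_cast <;> ring
          _ ≤ 2 ^ (-((i : ℝ) * a)) * 2 ^ (-((j : ℝ) * a)) * (M * min 1 (2 ^ ((j : ℝ) * b))) := by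
              gcongr
              rw [mul_min, mul_one, mul_comm M]
              gcongr
          _ = _ := by ring
    _ = 2 ^ (-((i : ℝ) * a)) * M * S := ENNReal.tsum_mul_left
    _ ≤ (2 ^ a * (M / K) ^ (-(a / b))) * M * S := by gcongr
    _ = 2 ^ a * S * (M ^ (-(a / b)) * M ^ (1 : ℝ) * K ^ (a / b)) := by
        rw [div_eq_mul_inv M K, ENNReal.mul_rpow_of_ne_top hMt (by simp [hK0]), ENNReal.inv_rpow,
          ENNReal.rpow_neg K, inv_inv, ENNReal.rpow_one]
        ring
    _ = _ := by
        rw [← ENNReal.rpow_add _ _ hM0 hMt]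
        congr 3; ring

/-- Hedberg's pointwise estimate. -/
lemma exists_fracPotential_le {α p q t : ℝ} (hα : 0 < α) (hαn : α < n) (hp : 1 < p) (hq : 0 < q)
    (ht : 0 < t) (hαt : α * t < n) :
    ∃ C : ℝ≥0∞, C ≠ ∞ ∧ ∀ g : Rn n → ℝ≥0∞, AEMeasurable g → ∀ K : ℝ≥0∞, K ≠ ∞ →
      (∀ z, localTerm g (ENNReal.ofReal p) (ENNReal.ofReal q) (ENNReal.ofReal t) z ≤ K) →
      ∀ x, fracPotential α g x ≤
        C * (maxBall g x ^ (1 - α * t / n) * K ^ (α * t / n)) := by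
  have hn0 : (0 : ℝ) < n := hα.trans hαn
  obtain ⟨A, hA, hle⟩ := exists_average_le_localTerm (n := n) hp hq ht
  set E : ℝ≥0∞ := (Fintype.card (Fin n → Fin 3) : ℝ≥0∞) with hE
  have hEA : E * A ≠ ∞ := ENNReal.mul_ne_top (by simp [hE]) hA
  -- The weight `2^(-jα)` comes from the kernel and the growth `2^(jn/t)` from the local terms; `a <
  -- b` is the condition `α t < n`.
  obtain ⟨D, hD, hle'⟩ := exists_tsum_int_min_le (a := α) (b := n * t⁻¹) hα
    (by rw [← div_eq_mul_inv, lt_div_iff₀ ht]; exact hαt)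
  have hexp : α / (n * t⁻¹) = α * t / n := by field_simp
  rw [hexp] at hle'
  have hpos : 0 ≤ α * t / n := by positivity
  refine ⟨2 ^ (n - α) * (D * (E * A) ^ (α * t / n)), ENNReal.mul_ne_top (by simp)
    (ENNReal.mul_ne_top hD (ENNReal.rpow_ne_top_of_nonneg hpos hEA)), fun g hg K hK hgK x => ?_⟩
  have havg : ∀ j : ℤ, 2 ^ ((j : ℝ) * n) * ∫⁻ y in Metric.closedBall x ((2 : ℝ) ^ (-j)), g y ≤
      min (maxBall g x) (2 ^ ((j : ℝ) * (n * t⁻¹)) * (E * A * K)) := by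
    intro j
    refine le_min (le_iSup (fun j : ℤ => 2 ^ ((j : ℝ) * n) *
      ∫⁻ y in Metric.closedBall x ((2 : ℝ) ^ (-j)), g y) j) ?_
    obtain ⟨m, hm⟩ := exists_mem_dyadicCube j x
    calc _ ≤ 2 ^ ((j : ℝ) * n) * ∑ e, ∫⁻ y in dyadicCube j (nbr m e), g y := by
          gcongr; exact setLIntegral_closedBall_le hm g
      _ ≤ ∑ e : Fin n → Fin 3, A * 2 ^ ((j : ℝ) * n * t⁻¹) * K := by
          rw [Finset.mul_sum]
          refine Finset.sum_le_sum fun e _ => (hle g hg j (nbr m e)).trans ?_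
          gcongr
          exact hgK _
      _ = _ := by
          rw [Finset.sum_const, nsmul_eq_mul, Finset.card_univ, ← hE, mul_assoc (j : ℝ)]; ring
  calc _ ≤ _ := fracPotential_le_tsum hαn hg x
    _ = ∑' j : ℤ, 2 ^ (n - α) * (2 ^ (-((j : ℝ) * α)) *
        (2 ^ ((j : ℝ) * n) * ∫⁻ y in Metric.closedBall x ((2 : ℝ) ^ (-j)), g y)) := by
        congr with j
        rw [← mul_assoc, ← mul_assoc, mul_assoc (2 ^ (n - α)),
          ← ENNReal.rpow_add _ _ (by simp) (by simp), ← ENNReal.rpow_add _ _ (by simp) (by simp)]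
        congr 2; ring
    _ ≤ ∑' j : ℤ, 2 ^ (n - α) * (2 ^ (-((j : ℝ) * α)) *
        min (maxBall g x) (2 ^ ((j : ℝ) * (n * t⁻¹)) * (E * A * K))) := by
        gcongr with j; exact havg j
    _ ≤ 2 ^ (n - α) * (D * (maxBall g x ^ (1 - α * t / n) * (E * A * K) ^ (α * t / n))) := by
        rw [ENNReal.tsum_mul_left]
        gcongr
        exact hle' _ _ (ENNReal.mul_ne_top hEA hK)
    _ = _ := by rw [ENNReal.mul_rpow_of_nonneg _ _ hpos]; ring

/-! ### Monotonicity, homogeneity and power scaling of the norms. -/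

section Norm

variable {ε ε' : Type*} [ENorm ε] [ENorm ε'] {p q t : ℝ} {r : ℝ≥0∞}

lemma localTerm_mono (hp : 0 < p) (hq : 0 < q) (ht : 0 < t) {f : Rn n → ε} {g : Rn n → ε'}
    (h : ∀ x, ‖f x‖ₑ ≤ ‖g x‖ₑ) (z : ℤ × (Fin n → ℤ)) :
    localTerm f (ENNReal.ofReal p) (ENNReal.ofReal q) (ENNReal.ofReal t) z ≤
      localTerm g (ENNReal.ofReal p) (ENNReal.ofReal q) (ENNReal.ofReal t) z := by
  obtain ⟨j, m⟩ := z
  rw [localTerm_eq _ hp hq ht, localTerm_eq _ hp hq ht]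
  gcongr
  exact lorentzInt_mono hq fun τ _ _ => rearr_mono h _ τ

lemma localTerm_const_mul_le (hp : 0 < p) (hq : 0 < q) (ht : 0 < t) {c : ℝ≥0∞} (hc : c ≠ ∞)
    (g : Rn n → ℝ≥0∞) (z : ℤ × (Fin n → ℤ)) :
    localTerm (fun x => c * g x) (ENNReal.ofReal p) (ENNReal.ofReal q) (ENNReal.ofReal t) z ≤
      c * localTerm g (ENNReal.ofReal p) (ENNReal.ofReal q) (ENNReal.ofReal t) z := by
  obtain ⟨j, m⟩ := z
  rw [localTerm_eq _ hp hq ht, localTerm_eq _ hp hq ht, mul_left_comm]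
  gcongr
  calc _ ≤ (c ^ q * lorentzInt p q (rearr g (volume.restrict (dyadicCube j m)))) ^ q⁻¹ := by
        rw [← lorentzInt_const_mul hq hc]
        gcongr
        exact lorentzInt_mono hq fun τ _ _ => rearr_const_mul_le c g _ τ
    _ = _ := by
        rw [ENNReal.mul_rpow_of_nonneg _ _ (by positivity), ENNReal.rpow_rpow_inv hq.ne']

lemma bmlNorm_le_const_mul {p q t : ℝ≥0∞} (hr : r ≠ 0) {f : Rn n → ε} {g : Rn n → ε'} (c : ℝ≥0∞)
    (h : ∀ z, localTerm f p q t z ≤ c * localTerm g p q t z) :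
    bmlNorm f p q t r ≤ c * bmlNorm g p q t r := by
  rcases eq_or_ne r ∞ with rfl | hrt
  · simp only [bmlNorm, if_true]
    rw [ENNReal.mul_iSup]
    exact iSup_mono h
  · have hr0 : 0 < r.toReal := ENNReal.toReal_pos hr hrt
    simp only [bmlNorm, hrt, if_false]
    calc _ ≤ (∑' z, (c * localTerm g p q t z) ^ r.toReal) ^ r.toReal⁻¹ := by
          gcongr with z; exact h z
      _ = (c ^ r.toReal * ∑' z, localTerm g p q t z ^ r.toReal) ^ r.toReal⁻¹ := by
          rw [← ENNReal.tsum_mul_left]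
          congr with z
          rw [ENNReal.mul_rpow_of_nonneg _ _ hr0.le]
      _ = _ := by
          rw [ENNReal.mul_rpow_of_nonneg _ _ (by positivity), ENNReal.rpow_rpow_inv hr0.ne']

lemma bmlNorm_mono (hp : 0 < p) (hq : 0 < q) (ht : 0 < t) (hr : r ≠ 0) {f : Rn n → ε}
    {g : Rn n → ε'} (h : ∀ x, ‖f x‖ₑ ≤ ‖g x‖ₑ) :
    bmlNorm f (ENNReal.ofReal p) (ENNReal.ofReal q) (ENNReal.ofReal t) r ≤
      bmlNorm g (ENNReal.ofReal p) (ENNReal.ofReal q) (ENNReal.ofReal t) r := by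
  simpa using bmlNorm_le_const_mul hr 1 fun z => by
    simpa using localTerm_mono hp hq ht h z

lemma bmlNorm_const_mul_le (hp : 0 < p) (hq : 0 < q) (ht : 0 < t) (hr : r ≠ 0) {c : ℝ≥0∞}
    (hc : c ≠ ∞) (g : Rn n → ℝ≥0∞) :
    bmlNorm (fun x => c * g x) (ENNReal.ofReal p) (ENNReal.ofReal q) (ENNReal.ofReal t) r ≤
      c * bmlNorm g (ENNReal.ofReal p) (ENNReal.ofReal q) (ENNReal.ofReal t) r :=
  bmlNorm_le_const_mul hr c fun z => localTerm_const_mul_le hp hq ht hc g z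

lemma localTerm_le_bmlNorm {p q t : ℝ≥0∞} (hr : r ≠ 0) (f : Rn n → ε) (z : ℤ × (Fin n → ℤ)) :
    localTerm f p q t z ≤ bmlNorm f p q t r := by
  rcases eq_or_ne r ∞ with rfl | hrt
  · simp only [bmlNorm, if_true]
    exact le_iSup (localTerm f p q t) z
  · have hr0 : 0 < r.toReal := ENNReal.toReal_pos hr hrt
    simp only [bmlNorm, hrt, if_false]
    rw [ENNReal.le_rpow_inv_iff hr0]
    exact ENNReal.le_tsum (f := fun z => localTerm f p q t z ^ r.toReal) z

/-- Rearrangement commutes with powers, and `1/t - 1/p = θ (1/(θt) - 1/(θp))`, so multiplying all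
indices by `θ` is compatible with the weight `|Q|`. -/
lemma localTerm_rpow {θ : ℝ} (hθ : 0 < θ) (hp : 0 < p) (hq : 0 < q) (ht : 0 < t)
    (g : Rn n → ℝ≥0∞) (z : ℤ × (Fin n → ℤ)) :
    localTerm (fun x => g x ^ θ) (ENNReal.ofReal p) (ENNReal.ofReal q) (ENNReal.ofReal t) z =
      localTerm g (ENNReal.ofReal (θ * p)) (ENNReal.ofReal (θ * q)) (ENNReal.ofReal (θ * t)) z
        ^ θ := by
  obtain ⟨j, m⟩ := z
  rw [localTerm_eq _ hp hq ht, localTerm_eq _ (by positivity) (by positivity) (by positivity),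
    ENNReal.mul_rpow_of_nonneg _ _ hθ.le, ← ENNReal.rpow_mul, ← ENNReal.rpow_mul]
  congr 1
  · congr 1; field_simp
  · rw [show (θ * q)⁻¹ * θ = q⁻¹ by field_simp]
    congr 1
    simp only [lorentzInt]
    congr with τ
    rw [rearr_rpow _ _ hθ, mul_comm θ q, mul_comm q θ, ENNReal.rpow_mul _ θ q,
      ENNReal.mul_rpow_of_nonneg _ _ hθ.le, ← ENNReal.rpow_mul _ _ θ,
      show (θ * p)⁻¹ * θ = p⁻¹ by field_simp]

lemma bmlNorm_rpow {θ : ℝ} (hθ : 0 < θ) (hp : 0 < p) (hq : 0 < q) (ht : 0 < t) (hr : r ≠ 0)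
    {r' : ℝ≥0∞} (hr' : (r = ∞ ∧ r' = ∞) ∨ (r ≠ ∞ ∧ r' ≠ ∞ ∧ r'.toReal = θ * r.toReal))
    (g : Rn n → ℝ≥0∞) :
    bmlNorm (fun x => g x ^ θ) (ENNReal.ofReal p) (ENNReal.ofReal q) (ENNReal.ofReal t) r =
      bmlNorm g (ENNReal.ofReal (θ * p)) (ENNReal.ofReal (θ * q)) (ENNReal.ofReal (θ * t)) r'
        ^ θ := by
  simp only [bmlNorm, localTerm_rpow hθ hp hq ht]
  rcases hr' with ⟨rfl, rfl⟩ | ⟨h1, h2, h3⟩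
  · simp only [if_true]
    exact ((ENNReal.orderIsoRpow θ hθ).map_iSup _).symm
  · have hr0 : 0 < r.toReal := ENNReal.toReal_pos hr h1
    simp only [h1, h2, if_false, h3, ← ENNReal.rpow_mul]
    rw [show (θ * r.toReal)⁻¹ * θ = r.toReal⁻¹ by field_simp]

/-- On each unit cube the weak bound makes the rearrangement finite at every `τ > 0`, so the set
where `g = ∞` has measure at most every such `τ`. -/
lemma ae_lt_top_of_bmlNorm_ne_top (hp : 0 < p) (hq : 0 < q) (ht : 0 < t) (hr : r ≠ 0)
    {g : Rn n → ℝ≥0∞}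
    (h : bmlNorm g (ENNReal.ofReal p) (ENNReal.ofReal q) (ENNReal.ofReal t) r ≠ ∞) :
    ∀ᵐ x, g x < ∞ := by
  have hcube : ∀ m : Fin n → ℤ, ∀ᵐ x, x ∈ dyadicCube 0 m → g x < ∞ := by
    intro m
    rw [← ae_restrict_iff' (measurableSet_dyadicCube 0 m)]
    set μ := volume.restrict (dyadicCube 0 m) with hμ
    have hloc : lorentzInt p q (rearr g μ) ≠ ∞ := by
      intro htop
      refine h (top_le_iff.1 (le_trans (le_of_eq ?_) (localTerm_le_bmlNorm hr g (0, m))))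
      rw [localTerm_eq _ hp hq ht, ← hμ, htop, ENNReal.top_rpow_of_pos (by positivity),
        ENNReal.mul_top (by simp)]
    have hle : ∀ τ : ℝ≥0∞, τ ≠ 0 → τ ≠ ∞ → μ {x | ¬ g x < ∞} ≤ τ := by
      intro τ h0 hτ
      have hfin : rearr g μ τ ≠ ∞ := by
        intro htop
        have := rpow_mul_le_lorentzInt hp hq (rearr_antitone g μ) h0 hτ
        rw [htop, ENNReal.mul_top (by simp [h0, hτ]), ENNReal.top_rpow_of_pos hq, top_le_iff] at this
        exact ENNReal.mul_ne_top (ENNReal.mul_ne_top (by simp) (by simp)) hloc this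
      refine le_trans (measure_mono fun x hx => ?_) (distrib_rearr_le g μ τ)
      have hx' : g x = ∞ := by simpa using hx
      simp only [mem_ofPred_eq, enorm_eq_self, hx']
      exact lt_top_iff_ne_top.2 hfin
    rw [ae_iff]
    by_contra hne
    obtain ⟨τ, h1, h2⟩ := exists_between (pos_iff_ne_zero.2 hne)
    exact absurd (hle τ h1.ne' (h2.trans_le le_top).ne) (not_le.2 h2)
  filter_upwards [ae_all_iff.2 hcube] with x hx
  obtain ⟨m, hm⟩ := exists_mem_dyadicCube 0 x
  exact hx m hm

end Norm

/-! ### The fractional maximal function and measurability of both operators. -/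

section Cube

lemma cube_eq_preimage (c : Rn n) (l : ℝ) : cube c l =
    WithLp.ofLp ⁻¹' (univ.pi fun i => Ioo (c i - l / 2) (c i + l / 2)) := by
  ext x
  simp only [cube, mem_ofPred_eq, mem_preimage, mem_univ_pi, mem_Ioo, abs_lt]
  refine forall_congr' fun i => ?_
  constructor <;> rintro ⟨h1, h2⟩ <;> constructor <;> linarith

lemma isOpen_cube (c : Rn n) (l : ℝ) : IsOpen (cube c l) := by
  rw [cube_eq_preimage]
  exact (isOpen_set_pi finite_univ fun i _ => isOpen_Ioo).preimage
    (PiLp.continuous_ofLp 2 fun _ : Fin n => ℝ)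

lemma volume_cube (c : Rn n) (l : ℝ) : volume (cube c l) = ENNReal.ofReal l ^ n := by
  rw [cube_eq_preimage, (PiLp.volume_preserving_ofLp (Fin n)).measure_preimage
    (MeasurableSet.univ_pi fun i => measurableSet_Ioo).nullMeasurableSet, Real.volume_pi_Ioo]
  have : ∀ i, c i + l / 2 - (c i - l / 2) = l := fun i => by ring
  simp [this]

lemma norm_sub_le_of_mem_cube {c x y : Rn n} {l : ℝ} (hl : 0 < l) (hx : x ∈ cube c l)
    (hy : y ∈ cube c l) : ‖x - y‖ ≤ n * l := by
  rw [← pow_le_pow_iff_left₀ (norm_nonneg _) (mul_nonneg n.cast_nonneg hl.le) two_ne_zero,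
    EuclideanSpace.norm_sq_eq]
  calc ∑ i, ‖(x - y) i‖ ^ 2 ≤ ∑ _i : Fin n, l ^ 2 := by
        refine Finset.sum_le_sum fun i _ => ?_
        gcongr
        have h1 := abs_lt.1 (hx i)
        have h2 := abs_lt.1 (hy i)
        simp only [PiLp.sub_apply, Real.norm_eq_abs]
        exact abs_le.2 ⟨by linarith, by linarith⟩
    _ = n * l ^ 2 := by simp
    _ ≤ (n * l) ^ 2 := by
        rw [mul_pow]
        gcongr
        exact_mod_cast Nat.le_self_pow two_ne_zero n

variable {𝕜 : Type*} [RCLike 𝕜]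

/-- For `x, y` in a cube of side `l` one has `|x - y| ≤ n l`, while `|Q|^(1 - α/n) = l^(n-α)`; so
the averaging kernel is at most `n^(n-α)` times the potential kernel. -/
lemma fracMaximal_le_fracPotential {α : ℝ} (hn : n ≠ 0) (hα : α < n) (f : Rn n → 𝕜) (x : Rn n) :
    fracMaximal α f x ≤ ENNReal.ofReal ((n : ℝ) ^ ((n : ℝ) - α)) *
      fracPotential α (fun y => ‖f y‖ₑ) x := by
  have hα' : 0 < (n : ℝ) - α := by linarith
  have hn0 : (0 : ℝ) < n := by positivity
  have : Nonempty (Fin n) := ⟨⟨0, Nat.pos_of_ne_zero hn⟩⟩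
  refine iSup_le fun c => iSup_le fun l => iSup_le fun hl => iSup_le fun hx => ?_
  rw [volume_cube c l, ← ENNReal.rpow_natCast, ← ENNReal.rpow_mul,
    show (n : ℝ) * (1 - α / n) = n - α by field_simp, fracPotential,
    ← lintegral_const_mul' _ _ (by simp), div_eq_mul_inv, mul_comm,
    ← lintegral_const_mul' _ _ (by simp [hl])]
  -- The comparison of kernels fails at `y = x`, where the potential kernel is zero by convention,
  -- so this null set is discarded.
  have hne : ∀ᵐ y ∂(volume : Measure (Rn n)), y ≠ x := by
    simp [ae_iff]
  calc _ ≤ ∫⁻ y in cube c l, ENNReal.ofReal ((n : ℝ) ^ ((n : ℝ) - α)) *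
        (ENNReal.ofReal (‖x - y‖ ^ ((n : ℝ) - α))⁻¹ * ‖f y‖ₑ) := by
        refine lintegral_mono_ae ?_
        rw [ae_restrict_iff' (isOpen_cube c l).measurableSet]
        filter_upwards [hne] with y hyx hy
        rw [← mul_assoc]
        gcongr
        have hd : 0 < ‖x - y‖ := norm_pos_iff.2 (sub_ne_zero.2 hyx.symm)
        rw [ENNReal.ofReal_rpow_of_pos hl, ← ENNReal.ofReal_inv_of_pos (by positivity),
          ← ENNReal.ofReal_mul (by positivity)]
        refine ENNReal.ofReal_le_ofReal ?_
        rw [← div_eq_mul_inv, inv_le_iff_one_le_mul₀ (by positivity), div_mul_eq_mul_div,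
          one_le_div (by positivity), ← Real.mul_rpow hn0.le hl.le]
        exact Real.rpow_le_rpow hd.le (norm_sub_le_of_mem_cube hl hx hy) hα'.le
    _ ≤ _ := setLIntegral_le_lintegral _ _

/-- The cubes are open, so this is a supremum of lower semicontinuous functions. -/
lemma measurable_fracMaximal (α : ℝ) (f : Rn n → 𝕜) : Measurable (fracMaximal α f) := by
  refine LowerSemicontinuous.measurable ?_
  refine lowerSemicontinuous_iSup fun c => lowerSemicontinuous_iSup fun l =>
    lowerSemicontinuous_iSup fun _ => ?_
  set v := (∫⁻ y in cube c l, ‖f y‖ₑ) / volume (cube c l) ^ (1 - α / n)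
  have : (fun x => ⨆ (_ : x ∈ cube c l), v) = (cube c l).indicator fun _ => v := by
    ext x
    by_cases h : x ∈ cube c l <;> simp [h]
  rw [this]
  exact (isOpen_cube c l).lowerSemicontinuous_indicator bot_le

lemma enorm_fracKernel (α : ℝ) (f : Rn n → 𝕜) (x y : Rn n) :
    ‖fracKernel α f x y‖ₑ = ENNReal.ofReal (‖x - y‖ ^ ((n : ℝ) - α))⁻¹ * ‖f y‖ₑ := by
  rw [fracKernel, enorm_smul, Real.enorm_of_nonneg (by positivity)]

lemma enorm_fracIntegral_le (α : ℝ) (f : Rn n → 𝕜) (x : Rn n) :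
    ‖fracIntegral α f x‖ₑ ≤ fracPotential α (fun y => ‖f y‖ₑ) x := by
  refine (enorm_integral_le_lintegral_enorm _).trans (le_of_eq ?_)
  simp only [enorm_fracKernel, fracPotential]

lemma aestronglyMeasurable_fracKernel (α : ℝ) {f : Rn n → 𝕜} (hf : AEStronglyMeasurable f volume)
    (x : Rn n) : AEStronglyMeasurable (fracKernel α f x) volume := by
  refine AEStronglyMeasurable.smul ?_ hf
  exact Measurable.aestronglyMeasurable (by fun_prop)

lemma aestronglyMeasurable_fracIntegral (α : ℝ) {f : Rn n → 𝕜}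
    (hf : AEStronglyMeasurable f volume) : AEStronglyMeasurable (fracIntegral α f) volume := by
  refine AEStronglyMeasurable.integral_prod_right' (μ := volume) (ν := volume)
    (f := fun z : Rn n × Rn n => fracKernel α f z.1 z.2) ?_
  refine AEStronglyMeasurable.smul ?_ hf.comp_snd
  exact Measurable.aestronglyMeasurable (by fun_prop)

end Cube

/-- The fractional integral of nonnegative functions is bounded between
Bourgain-Morrey-Lorentz spaces. -/
lemma exists_bmlNorm_fracPotential_le {α p q t θ : ℝ} {r r' : ℝ≥0∞} (hα : 0 < α) (hαn : α < n)
    (hp : 1 < θ * p) (hq : 0 < q) (ht : 0 < t) (hθ : 0 < θ) (hαt : α * (θ * t) / n = 1 - θ)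
    (hr : r ≠ 0) (hrt : ENNReal.ofReal (θ * t) < r')
    (hr' : (r = ∞ ∧ r' = ∞) ∨ (r ≠ ∞ ∧ r' ≠ ∞ ∧ r'.toReal = θ * r.toReal)) :
    ∃ C : ℝ≥0∞, C ≠ ∞ ∧ ∀ g : Rn n → ℝ≥0∞, AEMeasurable g →
      bmlNorm g (ENNReal.ofReal (θ * p)) (ENNReal.ofReal (θ * q)) (ENNReal.ofReal (θ * t)) r'
        ≠ ∞ →
      bmlNorm (fracPotential α g) (ENNReal.ofReal p) (ENNReal.ofReal q) (ENNReal.ofReal t) r ≤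
        C * bmlNorm g (ENNReal.ofReal (θ * p)) (ENNReal.ofReal (θ * q))
          (ENNReal.ofReal (θ * t)) r' := by
  have hn0 : (0 : ℝ) < n := hα.trans hαn
  have hn : n ≠ 0 := by rintro rfl; simp at hn0
  have hp0 : 0 < p := pos_of_mul_pos_right (zero_lt_one.trans hp) hθ.le
  have hθt : 0 < θ * t := by positivity
  have hθ1 : 0 ≤ 1 - θ := by rw [← hαt]; positivity
  have hr'0 : r' ≠ 0 := (lt_of_le_of_lt bot_le hrt).ne'
  obtain ⟨A, hA, hM⟩ := exists_bmlNorm_maxBall_le hn hp (q := θ * q) (by positivity) hθt hrt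
  obtain ⟨D, hD, hH⟩ := exists_fracPotential_le hα hαn hp (q := θ * q) (by positivity) hθt (by
    have : α * (θ * t) / n < 1 := by rw [hαt]; linarith
    rwa [div_lt_one hn0] at this)
  rw [hαt, sub_sub_cancel] at hH
  refine ⟨D * A ^ θ, ENNReal.mul_ne_top hD (ENNReal.rpow_ne_top_of_nonneg hθ.le hA),
    fun g hg hK => ?_⟩
  set K := bmlNorm g (ENNReal.ofReal (θ * p)) (ENNReal.ofReal (θ * q)) (ENNReal.ofReal (θ * t)) r'
  have hle : ∀ x, fracPotential α g x ≤ (D * K ^ (1 - θ)) * maxBall g x ^ θ := fun x =>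
    (hH g hg K hK (localTerm_le_bmlNorm hr'0 g) x).trans_eq (by ring)
  calc _ ≤ bmlNorm (fun x => (D * K ^ (1 - θ)) * maxBall g x ^ θ) (ENNReal.ofReal p)
        (ENNReal.ofReal q) (ENNReal.ofReal t) r :=
        bmlNorm_mono hp0 hq ht hr fun x => by simpa using hle x
    _ ≤ (D * K ^ (1 - θ)) * bmlNorm (fun x => maxBall g x ^ θ) (ENNReal.ofReal p)
        (ENNReal.ofReal q) (ENNReal.ofReal t) r :=
        bmlNorm_const_mul_le hp0 hq ht hr
          (ENNReal.mul_ne_top hD (ENNReal.rpow_ne_top_of_nonneg hθ1 hK)) _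
    _ ≤ (D * K ^ (1 - θ)) * (A * K) ^ θ := by
        rw [bmlNorm_rpow hθ hp0 hq ht hr hr']
        gcongr
        exact hM g hg
    _ = D * A ^ θ * (K ^ (1 - θ) * K ^ θ) := by rw [ENNReal.mul_rpow_of_nonneg _ _ hθ.le]; ring
    _ = _ := by
        rw [← ENNReal.rpow_add_of_nonneg _ _ hθ1 hθ.le, sub_add_cancel, ENNReal.rpow_one]

end

end BML

end

theorem mainTheorem6 {𝕜 : Type*} [RCLike 𝕜] (n : ℕ) (α : ℝ) (hα : 0 < α) (hαn : α < n)
    (p₁ p₂ q₁ q₂ t₁ t₂ : ℝ) (r₁ r₂ : ℝ≥0∞)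
    (hp₁ : 1 < p₁) (hp₂ : 1 < p₂) (hq₁ : 1 < q₁) (hq₂ : 1 < q₂) (ht₁ : 1 < t₁) (ht₂ : 1 < t₂)
    (ht : 1 / t₂ = 1 / t₁ - α / n)
    (hpt : p₁ / p₂ = t₁ / t₂) (hqt : q₁ / q₂ = t₁ / t₂)
    (hr :
      (p₁ < t₁ ∧ p₂ < t₂ ∧ ENNReal.ofReal t₁ < r₁ ∧ ENNReal.ofReal t₂ < r₂ ∧
        r₁ < ∞ ∧ r₂ < ∞ ∧ r₁.toReal / r₂.toReal = t₁ / t₂) ∨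
      (p₁ ≤ t₁ ∧ p₂ ≤ t₂ ∧ r₁ = ∞ ∧ r₂ = ∞)) :
    ∃ C : ℝ≥0, ∀ f : BML.Rn n → 𝕜,
      BML.MemBML f (ENNReal.ofReal p₁) (ENNReal.ofReal q₁) (ENNReal.ofReal t₁) r₁ →
        (∀ᵐ x, Integrable (BML.fracKernel α f x)) ∧
        BML.MemBML (BML.fracIntegral α f)
          (ENNReal.ofReal p₂) (ENNReal.ofReal q₂) (ENNReal.ofReal t₂) r₂ ∧
        BML.bmlNorm (BML.fracIntegral α f)
            (ENNReal.ofReal p₂) (ENNReal.ofReal q₂) (ENNReal.ofReal t₂) r₂ ≤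
          C * BML.bmlNorm f (ENNReal.ofReal p₁) (ENNReal.ofReal q₁) (ENNReal.ofReal t₁) r₁ ∧
        BML.MemBML (BML.fracMaximal α f)
          (ENNReal.ofReal p₂) (ENNReal.ofReal q₂) (ENNReal.ofReal t₂) r₂ ∧
        BML.bmlNorm (BML.fracMaximal α f)
            (ENNReal.ofReal p₂) (ENNReal.ofReal q₂) (ENNReal.ofReal t₂) r₂ ≤
          C * BML.bmlNorm f (ENNReal.ofReal p₁) (ENNReal.ofReal q₁) (ENNReal.ofReal t₁) r₁ := by
  have hn0 : (0 : ℝ) < n := hα.trans hαn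
  have hn : n ≠ 0 := by rintro rfl; simp at hn0
  obtain ⟨θ, hθ⟩ : ∃ θ, θ = t₁ / t₂ := ⟨_, rfl⟩
  have hθ0 : 0 < θ := by rw [hθ]; positivity
  have hp₂0 : 0 < p₂ := by linarith
  have hq₂0 : 0 < q₂ := by linarith
  have ht₂0 : 0 < t₂ := by linarith
  obtain rfl : t₁ = θ * t₂ := by rw [hθ]; field_simp
  rw [← hθ, div_eq_iff hp₂0.ne'] at hpt
  rw [← hθ, div_eq_iff hq₂0.ne'] at hqt
  subst hpt hqt
  -- The relation between `t₁`, `t₂` and `α` makes Hedberg's exponent of `K` equal to `1 - θ`,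
  -- leaving `θ` on the maximal function.
  have hαt : α * (θ * t₂) / n = 1 - θ := by
    have hα' : α / n = 1 / (θ * t₂) - 1 / t₂ := by linarith
    rw [mul_div_right_comm, hα']
    field_simp
  have hr₂0 : r₂ ≠ 0 := by
    rcases hr with h | h
    · exact (lt_of_le_of_lt bot_le h.2.2.2.1).ne'
    · simp [h.2.2.2]
  have hrt : ENNReal.ofReal (θ * t₂) < r₁ := by
    rcases hr with h | h
    · exact h.2.2.1
    · simp [h.2.2.1]
  have hrr : (r₂ = ∞ ∧ r₁ = ∞) ∨ (r₂ ≠ ∞ ∧ r₁ ≠ ∞ ∧ r₁.toReal = θ * r₂.toReal) := by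
    rcases hr with h | h
    · refine Or.inr ⟨h.2.2.2.2.2.1.ne, h.2.2.2.2.1.ne, ?_⟩
      have := h.2.2.2.2.2.2
      rwa [← hθ, div_eq_iff (ENNReal.toReal_pos hr₂0 h.2.2.2.2.2.1.ne).ne'] at this
    · exact Or.inl ⟨h.2.2.2, h.2.2.1⟩
  obtain ⟨C, hC, hle⟩ := BML.exists_bmlNorm_fracPotential_le hα hαn hp₁ hq₂0 ht₂0 hθ0 hαt hr₂0
    hrt hrr
  set D := ENNReal.ofReal ((n : ℝ) ^ ((n : ℝ) - α)) with hD
  -- One constant for both operators: the factor `1` serves `I_α`, and `D` is the cost of dominating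
  -- `M_α`.
  set C' := max 1 D * C with hC'
  have hC't : C' ≠ ∞ := ENNReal.mul_ne_top (by simp [hD]) hC
  refine ⟨C'.toNNReal, fun f ⟨hf, hfin⟩ => ?_⟩
  rw [ENNReal.coe_toNNReal hC't]
  have hnorm : BML.bmlNorm (fun y => ‖f y‖ₑ) (ENNReal.ofReal (θ * p₂)) (ENNReal.ofReal (θ * q₂))
      (ENNReal.ofReal (θ * t₂)) r₁ = BML.bmlNorm f (ENNReal.ofReal (θ * p₂))
      (ENNReal.ofReal (θ * q₂)) (ENNReal.ofReal (θ * t₂)) r₁ := by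
    simp only [BML.bmlNorm, BML.localTerm, BML.lorentzNorm, BML.rearr_enorm]
  have hpot := hle (fun y => ‖f y‖ₑ) hf.enorm (by rw [hnorm]; exact hfin.ne)
  rw [hnorm] at hpot
  set K := BML.bmlNorm f (ENNReal.ofReal (θ * p₂)) (ENNReal.ofReal (θ * q₂))
      (ENNReal.ofReal (θ * t₂)) r₁
  set F := BML.fracPotential α fun y => ‖f y‖ₑ with hF
  have hint : BML.bmlNorm (BML.fracIntegral α f) (ENNReal.ofReal p₂) (ENNReal.ofReal q₂)
      (ENNReal.ofReal t₂) r₂ ≤ C' * K := by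
    calc _ ≤ _ := BML.bmlNorm_mono hp₂0 hq₂0 ht₂0 hr₂0 (g := F) fun x => by
          simpa using BML.enorm_fracIntegral_le α f x
      _ ≤ C * K := hpot
      _ ≤ C' * K := by gcongr; exact le_mul_of_one_le_left bot_le (le_max_left _ _)
  have hmax : BML.bmlNorm (BML.fracMaximal α f) (ENNReal.ofReal p₂) (ENNReal.ofReal q₂)
      (ENNReal.ofReal t₂) r₂ ≤ C' * K := by
    calc _ ≤ _ := BML.bmlNorm_mono hp₂0 hq₂0 ht₂0 hr₂0 (g := fun x => D * F x) fun x => by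
          simpa using BML.fracMaximal_le_fracPotential hn hαn f x
      _ ≤ D * (C * K) := (BML.bmlNorm_const_mul_le hp₂0 hq₂0 ht₂0 hr₂0 (by simp [hD]) F).trans
          (by gcongr)
      _ ≤ C' * K := by rw [← mul_assoc, hC']; gcongr; exact le_max_right _ _
  have hCK : C' * K < ∞ := ENNReal.mul_lt_top hC't.lt_top hfin
  refine ⟨?_, ⟨BML.aestronglyMeasurable_fracIntegral α hf, hint.trans_lt hCK⟩, hint,
    ⟨(BML.measurable_fracMaximal α f).aestronglyMeasurable, hmax.trans_lt hCK⟩, hmax⟩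
  have hF' := BML.ae_lt_top_of_bmlNorm_ne_top hp₂0 hq₂0 ht₂0 hr₂0
    (hpot.trans_lt (ENNReal.mul_lt_top hC.lt_top hfin)).ne
  filter_upwards [hF'] with x hx
  refine ⟨BML.aestronglyMeasurable_fracKernel α hf x, ?_⟩
  rw [HasFiniteIntegral]
  simpa only [BML.enorm_fracKernel, hF, BML.fracPotential] using hx
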